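/- **Setting.** Let $\lambda$ be the security parameter and let $n,m\in\mathbb N$, $q$ prime and $\sigma>0$ depend on $\lambda$, with $n=\Theta(\lambda)$, $m\ge 6n$ (for example $m=\Theta(n)$ with a sufficiently large implied constant), $\sigma=O(\sqrt n)$ and $q=\Theta(m^{3.5})$. A function of $\lambda$ is negligible if it decays faster than every inverse polynomial. For a nonempty $\Lambda\subseteq\mathbb Z^k$ let $D_{\Lambda,\sigma}$ be the distribution on $\Lambda$ with $\Pr[x]$ proportional to $\exp(-\pi\|x\|^2/\sigma^2)$, and for $A\in\mathbb Z_q^{n\times m}$, $u\in\mathbb Z_q^n$ let $\Lambda_q^u(A)=\{r\in\mathbb Z^m: Ar=u \bmod q\}$. Let $\mathsf{TrapGen}$ and $\mathsf{SampleD}$ be any randomized procedures such that $\mathsf{TrapGen}$ outputs pairs $(A,T_A)\in\mathbb Z_q^{n\times m}\times\mathbb Z^{m\times m}$ with $A$ within negligible statistical distance of uniform and, for some negligible $\delta$, with probability at least $1-\delta$ over $(A,T_A)\leftarrow\mathsf{TrapGen}$, for every $u\in\mathbb Z_q^n$ the set $\Lambda_q^u(A)$ is nonempty and $\mathsf{SampleD}(A,T_A,u)$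 is within statistical distance $\delta$ of $D_{\Lambda_q^u(A),\sigma}$. For a hash function $H:\{0,1\}^n\to\mathbb Z_q^{n\times n}$ and an identity $id$, put $U=H(id)$. The identity key is the matrix $R\in\mathbb Z^{m\times n}$ whose columns are sampled independently by $\mathsf{SampleD}(A,T_A,\cdot)$ for the columns of $U$ (so that $AR=U \bmod q$ up to negligible probability). The encryption randomness consists of independent $s\in\mathbb Z_q^n$ uniform, $e_0\leftarrow D_{\mathbb Z^n,\sigma}$ and $e\leftarrow D_{\mathbb Z^m,\sigma}$. Put $x=(U^\top s+e_0)\bmod q$ and $c_1=(A^\top s+e)\bmod q$. The ciphertext of $\sum_{\mu\in\{0,1\}^n}\alpha_\mu|\mu\rangle$ is $\bigl(c_1,\ \sum_\mu\alpha_\mu|(x+\lfloor q/2\rfloor\mu)\bmod q\rangle\bigr)$, where a residue is stored, by its representative in $[0,q)$, in $\ell=\lfloor\log_2 q+1\rfloor$ qubits. **Decryption.** $\mathsf{QDecrypt}$ computes $y=R^\top c_1\bmod q$. For each of the $n$ coordinates $i$ it adjoins a blank message qubit, registers containing $y_i$, $\lfloor q/2\rfloor$ and $\lfloor q/4\rfloor$,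 a blank $\ell$-qubit copy register, and one further (most significant) qubit for the ciphertext register, which is then called the work register. It applies the following ten unitaries, each a permutation of the computational basis applied coordinatewise: (1) subtract $y_i$ modulo $q$ from the work register; (2) subtract $\lfloor q/2\rfloor$ from it, in two's complement; (3) replace the content by its absolute value, keeping the sign qubit; (4) flip the message qubit if the absolute value is less than $\lfloor q/4\rfloor$; (5)–(7) undo (3), (2), (1) in this order; (8) XOR $\lfloor q/2\rfloor$ into the copy register, controlled by the message qubit; (9) subtract the copy register modulo $q$ from the work register; (10) undo (8). (Addition and subtraction modulo $q$ act as the identity on basis states in which one of the two operands is not in $[0,q)$.) **Statement.** There is a negligible $\varepsilon(\lambda)$, independent of $H$, $id$ and the message, such that for every $\lambda$, with probability at least $1-\varepsilon(\lambda)$ over $(A,T_A)\leftarrow\mathsf{TrapGen}$, the following holds for all $H$ and all $id$: with probability at least $1-\varepsilon(\lambda)$ over $R$, $s$, $e_0$, $e$, simultaneously for all message states $\sum_\mu\alpha_\mu|\mu\rangle$, the final state of $\mathsf{QDecrypt}$ on the ciphertext is $$\Bigl(\sum_\mu\alpha_\mu|\mu\rangle\Bigr)\otimes|\mathrm{aux}\rangle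 ,$$ where $|\mathrm{aux}\rangle$ is a computational basis state of the other registers that does not depend on the message: the work register contains $x$, the copy register contains $0$, and the registers of $y$, $\lfloor q/2\rfloor$ and $\lfloor q/4\rfloor$ are unchanged. In particular the message register is not entangled with any other register. -/

import Mathlib

open scoped ENNReal

noncomputable section

namespace QIBE

/-! ### Probability: sampling, statistical distance, discrete Gaussians -/

/-- A function of the security parameter is negligible if it decays faster than every inverse
polynomial. -/
def Negligible (ε : ℕ → ℝ) : Prop :=
  Asymptotics.SuperpolynomialDecay Filter.atTop (fun k : ℕ => (k : ℝ)) ε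

/-- The probability of an event under a discrete distribution, as a real number. -/
def prob {α : Type*} (p : PMF α) (E : Set α) : ℝ :=
  (p.toOuterMeasure E).toReal

/-- Statistical distance `(1/2) ∑ |P(a) - Q(a)|`. -/
def statDist {α : Type*} (P Q : PMF α) : ℝ :=
  (1 / 2) * ∑' a, |(P a).toReal - (Q a).toReal|

/-- Independent sampling: the joint distribution of `k` independent samples, the `i`-th one being
drawn from `p i`. -/
def independent {α : Type*} : {k : ℕ} → (Fin k → PMF α) → PMF (Fin k → α)
  | 0, _ => PMF.pure Fin.elim0
  | _ + 1, p => (p 0).bind fun a => (independent fun i => p i.succ).map (Fin.cons a)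

/-- The Gaussian weight `ρ_σ(x) = exp (-π ‖x‖² / σ²)` of an integer vector. -/
def gaussianWeight (σ : ℝ) {k : ℕ} (x : Fin k → ℤ) : ℝ≥0∞ :=
  ENNReal.ofReal (Real.exp (-Real.pi * (∑ i, (x i : ℝ) ^ 2) / σ ^ 2))

theorem gaussianWeight_ne_zero (σ : ℝ) {k : ℕ} (x : Fin k → ℤ) : gaussianWeight σ x ≠ 0 := by
  simp [gaussianWeight, Real.exp_pos]

theorem gaussianWeight_cons (σ : ℝ) {k : ℕ} (a : ℤ) (x : Fin k → ℤ) :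
    gaussianWeight σ (Fin.cons a x : Fin (k + 1) → ℤ)
      = ENNReal.ofReal (Real.exp (-Real.pi * (a : ℝ) ^ 2 / σ ^ 2)) * gaussianWeight σ x := by
  unfold gaussianWeight
  rw [← ENNReal.ofReal_mul (Real.exp_pos _).le, ← Real.exp_add]
  congr 2
  simp only [Fin.sum_univ_succ, Fin.cons_zero, Fin.cons_succ]
  ring

theorem summable_gaussian_int (σ : ℝ) (hσ : 0 < σ) :
    Summable fun a : ℤ => Real.exp (-Real.pi * (a : ℝ) ^ 2 / σ ^ 2) := by
  have key : Summable fun j : ℕ => Real.exp (-Real.pi * (j : ℝ) ^ 2 / σ ^ 2) := by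
    have hc : 0 < Real.pi / σ ^ 2 := div_pos Real.pi_pos (by positivity)
    have hg : Summable fun j : ℕ => Real.exp (-(Real.pi / σ ^ 2)) ^ j :=
      summable_geometric_of_lt_one (Real.exp_pos _).le (by rw [Real.exp_lt_one_iff]; linarith)
    refine Summable.of_nonneg_of_le (fun j => (Real.exp_pos _).le) (fun j => ?_) hg
    rw [← Real.exp_nat_mul]
    apply Real.exp_le_exp.mpr
    have h1 : (j : ℝ) ≤ (j : ℝ) ^ 2 := by
      exact_mod_cast Nat.le_self_pow (by norm_num) j
    have h2 : -Real.pi * (j : ℝ) ^ 2 / σ ^ 2 = -(Real.pi / σ ^ 2 * (j : ℝ) ^ 2) := by ring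
    rw [h2]
    nlinarith
  refine Summable.of_nat_of_neg ?_ ?_
  · simpa using key
  · simpa using key

theorem tsum_gaussianWeight_ne_top (σ : ℝ) (hσ : 0 < σ) (k : ℕ) :
    (∑' x : Fin k → ℤ, gaussianWeight σ x) ≠ ∞ := by
  induction k with
  | zero => simp [gaussianWeight]
  | succ k ih =>
    rw [← (Fin.consEquiv fun _ : Fin (k + 1) => ℤ).tsum_eq, ENNReal.tsum_prod']
    simp only [Fin.consEquiv, Equiv.coe_fn_mk, gaussianWeight_cons, ENNReal.tsum_mul_left,
      ENNReal.tsum_mul_right]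
    exact ENNReal.mul_ne_top (summable_gaussian_int σ hσ).tsum_ofReal_ne_top ih

/-- The discrete Gaussian distribution `D_{Λ,σ}` on a nonempty set `Λ` of integer vectors:
`x ∈ Λ` has probability `ρ_σ(x) / ρ_σ(Λ)`. -/
def discreteGaussian {k : ℕ} (Λ : Set (Fin k → ℤ)) (hΛ : Λ.Nonempty) (σ : ℝ) (hσ : 0 < σ) :
    PMF (Fin k → ℤ) :=
  PMF.normalize (Λ.indicator (gaussianWeight σ))
    (by
      obtain ⟨x, hx⟩ := hΛ
      intro h
      have := ENNReal.tsum_eq_zero.mp h x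
      rw [Set.indicator_of_mem hx] at this
      exact gaussianWeight_ne_zero σ x this)
    (ne_top_of_le_ne_top (tsum_gaussianWeight_ne_top σ hσ k)
      (ENNReal.tsum_le_tsum fun x => Set.indicator_le_self _ _ x))

/-- Reduction of an integer vector modulo `q`. -/
def modVec (q : ℕ) {k : ℕ} (v : Fin k → ℤ) : Fin k → ZMod q := fun i => (v i : ZMod q)

/-- The coset `{ r ∈ ℤ^m : A r = u mod q }` of integer vectors with syndrome `u`. -/
def syndromes {q n m : ℕ} (A : Matrix (Fin n) (Fin m) (ZMod q)) (u : Fin n → ZMod q) :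
    Set (Fin m → ℤ) :=
  {r | A.mulVec (modVec q r) = u}

/-! ### Quantum registers -/

/-- Number of qubits of a register that holds a residue modulo `q`, namely `⌊log₂ q + 1⌋`. -/
def regLen (q : ℕ) : ℕ := Nat.log 2 q + 1

theorem lt_two_pow_regLen (q : ℕ) : q < 2 ^ regLen q :=
  Nat.lt_pow_succ_log_self (by norm_num) q

instance instFintypeBitVec (w : ℕ) : Fintype (BitVec w) :=
  Fintype.ofEquiv (Fin (2 ^ w)) ⟨BitVec.ofFin, BitVec.toFin, fun _ => rfl, fun _ => rfl⟩

/-- The state space of a system of qubits with computational basis `B`. -/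
abbrev State (B : Type) [Fintype B] := EuclideanSpace ℂ B

open Classical in
/-- The computational basis vector `|b⟩`. -/
def ket {B : Type} [Fintype B] (b : B) : State B := EuclideanSpace.single b 1

/-- The tensor product of two state vectors. -/
def tensor {B C : Type} [Fintype B] [Fintype C] (φ : State B) (χ : State C) : State (B × C) :=
  WithLp.toLp 2 fun p => φ p.1 * χ p.2

/-- The unitary `|b⟩ ↦ |p b⟩` of a reversible classical computation `p`. -/
def unitaryOf {B : Type} [Fintype B] (p : Equiv.Perm B) : State B ≃ₗᵢ[ℂ] State B :=
  LinearIsometryEquiv.piLpCongrLeft 2 ℂ ℂ p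

/-- The registers, other than the one-qubit message register, that decryption uses for one
coordinate: the registers holding `y_i`, `⌊q/2⌋` and `⌊q/4⌋`, the work register, which holds the
ciphertext coordinate and one additional (most significant) qubit, and the register into which
`⌊q/2⌋ m_i` is copied. -/
@[ext]
structure Aux (q : ℕ) where
  key : BitVec (regLen q)
  half : BitVec (regLen q)
  quarter : BitVec (regLen q)
  work : BitVec (regLen q + 1)
  copy : BitVec (regLen q)
  deriving DecidableEq, Fintype

/-! ### Reversible arithmetic networks -/

/-- The network `|a, b⟩ ↦ |a, (a + b) mod q⟩` for `a, b < q`, as a permutation of the basis states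
of the second register. Basis states outside this range are left alone. -/
def modAdd (q : ℕ) (a : BitVec (regLen q)) : Equiv.Perm (BitVec (regLen q + 1)) where
  toFun b := if a.toNat < q ∧ b.toNat < q then BitVec.ofNat _ ((a.toNat + b.toNat) % q) else b
  invFun b := if a.toNat < q ∧ b.toNat < q then BitVec.ofNat _ ((b.toNat + (q - a.toNat)) % q) else b
  left_inv b := by
    have hq : q < 2 ^ (regLen q + 1) :=
      (lt_two_pow_regLen q).trans (Nat.pow_lt_pow_right (by norm_num) (Nat.lt_succ_self _))
    by_cases h : a.toNat < q ∧ b.toNat < q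
    · have hr : (a.toNat + b.toNat) % q < q := Nat.mod_lt _ (by omega)
      have hm : ((a.toNat + b.toNat) % q) % 2 ^ (regLen q + 1) = (a.toNat + b.toNat) % q :=
        Nat.mod_eq_of_lt (hr.trans hq)
      simp only [h, and_self, if_true, BitVec.toNat_ofNat, hm, hr]
      apply BitVec.eq_of_toNat_eq
      have he : ((a.toNat + b.toNat) % q + (q - a.toNat)) % q = b.toNat := by
        rw [Nat.mod_add_mod, show a.toNat + b.toNat + (q - a.toNat) = b.toNat + q by omega,
          Nat.add_mod_right, Nat.mod_eq_of_lt h.2]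
      rw [he, BitVec.toNat_ofNat, Nat.mod_eq_of_lt (h.2.trans hq)]
    · simp only [h, if_false]
  right_inv b := by
    have hq : q < 2 ^ (regLen q + 1) :=
      (lt_two_pow_regLen q).trans (Nat.pow_lt_pow_right (by norm_num) (Nat.lt_succ_self _))
    by_cases h : a.toNat < q ∧ b.toNat < q
    · have hr : (b.toNat + (q - a.toNat)) % q < q := Nat.mod_lt _ (by omega)
      have hm : ((b.toNat + (q - a.toNat)) % q) % 2 ^ (regLen q + 1)
          = (b.toNat + (q - a.toNat)) % q := Nat.mod_eq_of_lt (hr.trans hq)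
      simp only [h, and_self, if_true, BitVec.toNat_ofNat, hm, hr]
      apply BitVec.eq_of_toNat_eq
      have he : (a.toNat + (b.toNat + (q - a.toNat)) % q) % q = b.toNat := by
        rw [Nat.add_mod_mod, show a.toNat + (b.toNat + (q - a.toNat)) = b.toNat + q by omega,
          Nat.add_mod_right, Nat.mod_eq_of_lt h.2]
      rw [he, BitVec.toNat_ofNat, Nat.mod_eq_of_lt (h.2.trans hq)]
    · simp only [h, if_false]

/-- The subtraction network `|a, b⟩ ↦ |a, b - a⟩`; the second register has one more qubit and holds
negative results in two's complement. Its inverse is the addition network. -/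
def subNet {w : ℕ} (a : BitVec w) : Equiv.Perm (BitVec (w + 1)) where
  toFun b := b - a.setWidth (w + 1)
  invFun b := b + a.setWidth (w + 1)
  left_inv b := BitVec.sub_add_cancel b _
  right_inv b := BitVec.add_sub_cancel b _

/-- The absolute value network: controlled on the most significant (sign) qubit, the remaining
qubits are negated bitwise and incremented. The sign qubit is kept, so a number in two's complement
becomes its sign followed by its absolute value. -/
def absNet (w : ℕ) : Equiv.Perm (BitVec (w + 1)) where
  toFun b := if b.msb then BitVec.cons true (~~~(b.setWidth w) + 1#w) else b
  invFun b := if b.msb then BitVec.cons true (~~~(b.setWidth w) + 1#w) else b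
  left_inv b := by
    by_cases h : b.msb
    · have hb := BitVec.cons_msb_setWidth b
      rw [h] at hb
      simp only [h, if_true, BitVec.msb_cons, BitVec.setWidth_cons, ← BitVec.neg_eq_not_add,
        BitVec.neg_neg, hb]
    · simp [h]
  right_inv b := by
    by_cases h : b.msb
    · have hb := BitVec.cons_msb_setWidth b
      rw [h] at hb
      simp only [h, if_true, BitVec.msb_cons, BitVec.setWidth_cons, ← BitVec.neg_eq_not_add,
        BitVec.neg_neg, hb]
    · simp [h]

/-- A permutation of the work register, controlled by the other registers. -/
def onWork {q : ℕ} (f : Aux q → Equiv.Perm (BitVec (regLen q + 1)))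
    (hf : ∀ (r : Aux q) (w : BitVec (regLen q + 1)), f { r with work := w } = f r) :
    Equiv.Perm (Bool × Aux q) where
  toFun r := (r.1, { r.2 with work := f r.2 r.2.work })
  invFun r := (r.1, { r.2 with work := (f r.2).symm r.2.work })
  left_inv r := by simp [hf]
  right_inv r := by simp [hf]

/-- Adder modulo `q` with inputs the register holding `y_i` and the work register. -/
def addKey (q : ℕ) : Equiv.Perm (Bool × Aux q) :=
  onWork (fun r => modAdd q r.key) fun _ _ => rfl

/-- Subtraction of the register holding `⌊q/2⌋` from the work register. -/
def subHalf (q : ℕ) : Equiv.Perm (Bool × Aux q) :=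
  onWork (fun r => subNet r.half) fun _ _ => rfl

/-- Absolute value of the work register. -/
def absWork (q : ℕ) : Equiv.Perm (Bool × Aux q) :=
  onWork (fun _ => absNet (regLen q)) fun _ _ => rfl

/-- Adder modulo `q` with inputs the copy register and the work register. -/
def addCopy (q : ℕ) : Equiv.Perm (Bool × Aux q) :=
  onWork (fun r => modAdd q r.copy) fun _ _ => rfl

/-- Comparison network: the message qubit is flipped if the absolute value held in the work register
(without the sign qubit) is less than the content of the register holding `⌊q/4⌋`. -/
def compareQuarter (q : ℕ) : Equiv.Perm (Bool × Aux q) where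
  toFun r := (r.1 ^^ decide ((r.2.work.setWidth (regLen q)).toNat < r.2.quarter.toNat), r.2)
  invFun r := (r.1 ^^ decide ((r.2.work.setWidth (regLen q)).toNat < r.2.quarter.toNat), r.2)
  left_inv r := by simp
  right_inv r := by simp

/-- Controlled copying of the classical constant `⌊q/2⌋`: a CNOT from the message qubit to each qubit
of the copy register at which the binary expansion of `⌊q/2⌋` has a one. -/
def copyHalf (q : ℕ) : Equiv.Perm (Bool × Aux q) where
  toFun r := (r.1, { r.2 with
    copy := r.2.copy ^^^ (if r.1 then BitVec.ofNat (regLen q) (q / 2) else 0#(regLen q)) })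
  invFun r := (r.1, { r.2 with
    copy := r.2.copy ^^^ (if r.1 then BitVec.ofNat (regLen q) (q / 2) else 0#(regLen q)) })
  left_inv r := by simp
  right_inv r := by simp

/-- `n`-fold expansion: a one-coordinate network is applied to each of the `n` coordinates. -/
def expand (n : ℕ) {q : ℕ} (p : Equiv.Perm (Bool × Aux q)) :
    Equiv.Perm ((Fin n → Bool) × (Fin n → Aux q)) :=
  ((Equiv.arrowProdEquivProdArrow (Fin n) (fun _ => Bool) (fun _ => Aux q)).symm.trans
    (Equiv.piCongrRight fun _ => p)).trans
    (Equiv.arrowProdEquivProdArrow (Fin n) (fun _ => Bool) (fun _ => Aux q))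

/-- The unitary that a one-coordinate network induces on all `n` coordinates. -/
def stepU (n : ℕ) {q : ℕ} (p : Equiv.Perm (Bool × Aux q)) :
    State ((Fin n → Bool) × (Fin n → Aux q)) ≃ₗᵢ[ℂ] State ((Fin n → Bool) × (Fin n → Aux q)) :=
  unitaryOf (expand n p)

/-- The ten unitary steps of quantum decryption, in this order. -/
def decryptU (n q : ℕ) :
    State ((Fin n → Bool) × (Fin n → Aux q)) ≃ₗᵢ[ℂ] State ((Fin n → Bool) × (Fin n → Aux q)) :=
  (stepU n (addKey q).symm).trans <|
  (stepU n (subHalf q)).trans <|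
  (stepU n (absWork q)).trans <|
  (stepU n (compareQuarter q)).trans <|
  (stepU n (absWork q).symm).trans <|
  (stepU n (subHalf q).symm).trans <|
  (stepU n (addKey q)).trans <|
  (stepU n (copyHalf q)).trans <|
  (stepU n (addCopy q).symm).trans <|
  stepU n (copyHalf q).symm

/-! ### The scheme -/

/-- The register content that represents the residue `a`, by its representative in `[0, q)`. -/
def encodeZMod {q : ℕ} (a : ZMod q) : BitVec (regLen q) := BitVec.ofNat _ a.val

/-- The registers of one coordinate when the work register contains `w` and the copy register is
blank: the key register contains `y`, and the constants are loaded. -/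
def auxWith {q : ℕ} (y : ZMod q) (w : BitVec (regLen q)) : Aux q where
  key := encodeZMod y
  half := BitVec.ofNat _ (q / 2)
  quarter := BitVec.ofNat _ (q / 4)
  work := w.setWidth (regLen q + 1)
  copy := 0#(regLen q)

/-- Adjoin to a state of the ciphertext registers the registers in `auxWith`. -/
def load {n q : ℕ} (y : Fin n → ZMod q) (ψ : State (Fin n → BitVec (regLen q))) :
    State (Fin n → Aux q) :=
  ∑ c : Fin n → BitVec (regLen q), ψ c • ket fun i => auxWith (y i) (c i)

/-- Quantum decryption of `(c₁, ψ)` with the identity key `R`: compute `y = Rᵀ c₁ mod q`, adjoin the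
auxiliary registers and blank message qubits, and run the ten steps. The result is the state of all
registers, with the message register as the first tensor factor. -/
def qDecrypt {n m q : ℕ} (R : Matrix (Fin m) (Fin n) ℤ) (c₁ : Fin m → ZMod q)
    (ψ : State (Fin n → BitVec (regLen q))) : State ((Fin n → Bool) × (Fin n → Aux q)) :=
  decryptU n q (tensor (ket fun _ => false)
    (load ((R.map (Int.cast : ℤ → ZMod q)).transpose.mulVec c₁) ψ))

/-- The quantum part `∑_μ α_μ |(x + ⌊q/2⌋ μ) mod q⟩` of a ciphertext of `∑_μ α_μ |μ⟩`. -/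
def cipherState {n q : ℕ} (x : Fin n → ZMod q) (α : State (Fin n → Bool)) :
    State (Fin n → BitVec (regLen q)) :=
  ∑ μ : Fin n → Bool,
    α μ • ket fun i => encodeZMod (x i + ((q / 2 : ℕ) : ZMod q) * (if μ i then 1 else 0))

/-- The identity key: the columns of `R` are sampled independently by `sampleD` for the columns
of `U`. -/
def extract {n m q : ℕ} (sampleD : (Fin n → ZMod q) → PMF (Fin m → ℤ))
    (U : Matrix (Fin n) (Fin n) (ZMod q)) : PMF (Matrix (Fin m) (Fin n) ℤ) :=
  (independent fun i : Fin n => sampleD fun j => U j i).map fun r => Matrix.of fun j i => r i j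

/-- The encryption randomness `(s, e₀, e)`: `s` is uniform in `ℤ_q^n`, and `e₀` and `e` are discrete
Gaussian in `ℤ^n` and `ℤ^m`; the three are independent. -/
def encryptCoins (n m q : ℕ) [NeZero q] (σ : ℝ) (hσ : 0 < σ) :
    PMF ((Fin n → ZMod q) × (Fin n → ℤ) × (Fin m → ℤ)) :=
  (PMF.uniformOfFintype (Fin n → ZMod q)).bind fun s =>
    (discreteGaussian (Set.univ : Set (Fin n → ℤ)) Set.univ_nonempty σ hσ).bind fun e₀ =>
      (discreteGaussian (Set.univ : Set (Fin m → ℤ)) Set.univ_nonempty σ hσ).map fun e =>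
        (s, e₀, e)

/-- The identity key and, independently, the encryption randomness. -/
def keyAndCoins {n m q : ℕ} [NeZero q] (σ : ℝ) (hσ : 0 < σ)
    (sampleD : (Fin n → ZMod q) → PMF (Fin m → ℤ)) (U : Matrix (Fin n) (Fin n) (ZMod q)) :
    PMF (Matrix (Fin m) (Fin n) ℤ × (Fin n → ZMod q) × (Fin n → ℤ) × (Fin m → ℤ)) :=
  (extract sampleD U).bind fun R => (encryptCoins n m q σ hσ).map fun t => (R, t)

/-- Decryption succeeds for the key `R` and the encryption randomness `(s, e₀, e)`: with
`x = Uᵀ s + e₀` and `c₁ = Aᵀ s + e` modulo `q`, decryption maps the ciphertext of every message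
state `α` to `α` tensored with a basis state of the other registers that does not depend on `α`,
in which the work register contains `x` and the copy register is blank again. -/
def Decrypts {n m q : ℕ} (A : Matrix (Fin n) (Fin m) (ZMod q)) (U : Matrix (Fin n) (Fin n) (ZMod q))
    (R : Matrix (Fin m) (Fin n) ℤ) (s : Fin n → ZMod q) (e₀ : Fin n → ℤ) (e : Fin m → ℤ) : Prop :=
  let x : Fin n → ZMod q := U.transpose.mulVec s + modVec q e₀
  let c₁ : Fin m → ZMod q := A.transpose.mulVec s + modVec q e
  let y : Fin n → ZMod q := (R.map (Int.cast : ℤ → ZMod q)).transpose.mulVec c₁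
  ∀ α : State (Fin n → Bool),
    qDecrypt R c₁ (cipherState x α)
      = tensor α (ket fun i => auxWith (y i) (encodeZMod (x i)))

end QIBE

end

/-!
Decryption computes `y = Rᵀ c₁`, and `A R = U` gives `x - y = e₀ - Rᵀ e` modulo `q`. The ten networks
permute basis states, so it suffices to follow one coordinate of one basis state: if `x - y` has a
representative `v` with `|v| < ⌊q/4⌋`, the comparison of `|v + ⌊q/2⌋ μ - ⌊q/2⌋|` (taken on
representatives in `[0, q)`) with `⌊q/4⌋` reveals `μ`, and the remaining networks uncompute everything
else (`decryptBasis_auxWith`); `qDecrypt_cipherState` extends this to superpositions by linearity.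

It remains to bound `e₀ - Rᵀ e`. By Cauchy–Schwarz this needs bounds on the norms of `e₀`, of `e` and
of the columns of `R`. Since `σ` has no lower bound, smoothness of the discrete Gaussian on a coset
`Λ_q^u(A)` is not available, and a column of `R` cannot be expected to have norm `σ √m`. Two facts
replace it.

* For almost all `A`, every coset contains a vector of the box `[0, b)^m` with `b ≈ 2 q^(1/3)`
  (`prob_uniform_no_short_syndrome_le`). This is a second moment argument: matrices are a universal
  family of hash functions, so all but a `q^(2n) / b^m` fraction of them map the box onto `ℤ_q^n`, and
  `m ≥ 6 n` makes this at most `64^(-n)`. The distribution of `A` is close to uniform, so this carries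
  over to the trapdoor generator.
* A discrete Gaussian on any set that contains a vector `r` has squared norm at most
  `2 ‖r‖² + 2 σ² m (1 + σ)` except with probability `exp (-m)` (`prob_discreteGaussian_tail_le`): the
  normalizing sum is at least the weight of `r`, and the tail is at most a small multiple of the
  Gaussian sum of width `2 σ` over `ℤ^m`.

With `σ = O(√m)` and `m = O(q^(2/7))` the noise is `O(q^(5/6))`, hence less than `⌊q/4⌋` for all large
`λ` (`eventually_exists_parameters`).
-/

noncomputable section

namespace QIBE

/-! ### Probabilities of events -/

theorem prob_nonneg {α : Type*} (p : PMF α) (E : Set α) : 0 ≤ prob p E := ENNReal.toReal_nonneg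

theorem toOuterMeasure_le_one {α : Type*} (p : PMF α) (E : Set α) : p.toOuterMeasure E ≤ 1 := by
  rw [PMF.toOuterMeasure_apply, ← p.tsum_coe]
  exact ENNReal.tsum_le_tsum fun x => Set.indicator_le_self _ _ x

theorem toOuterMeasure_ne_top {α : Type*} (p : PMF α) (E : Set α) : p.toOuterMeasure E ≠ ∞ :=
  ne_top_of_le_ne_top ENNReal.one_ne_top (toOuterMeasure_le_one p E)

theorem ofReal_prob {α : Type*} (p : PMF α) (E : Set α) :
    ENNReal.ofReal (prob p E) = p.toOuterMeasure E :=
  ENNReal.ofReal_toReal (toOuterMeasure_ne_top p E)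

theorem prob_le_of_toOuterMeasure_le {α : Type*} {p : PMF α} {E : Set α} {c : ℝ} (hc : 0 ≤ c)
    (h : p.toOuterMeasure E ≤ ENNReal.ofReal c) : prob p E ≤ c :=
  ENNReal.toReal_le_of_le_ofReal hc h

theorem prob_mono {α : Type*} (p : PMF α) {E F : Set α} (h : E ⊆ F) : prob p E ≤ prob p F :=
  ENNReal.toReal_mono (toOuterMeasure_ne_top p F) (p.toOuterMeasure.mono h)

theorem prob_union_le {α : Type*} (p : PMF α) (E F : Set α) :
    prob p (E ∪ F) ≤ prob p E + prob p F := by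
  refine prob_le_of_toOuterMeasure_le (add_nonneg (prob_nonneg p E) (prob_nonneg p F)) ?_
  rw [ENNReal.ofReal_add (prob_nonneg p E) (prob_nonneg p F), ofReal_prob, ofReal_prob]
  exact MeasureTheory.measure_union_le E F

theorem summable_toReal {α : Type*} (p : PMF α) : Summable fun a => (p a).toReal :=
  ENNReal.summable_toReal (by simp [p.tsum_coe])

theorem prob_eq_tsum {α : Type*} (p : PMF α) (E : Set α) :
    prob p E = ∑' a, E.indicator (fun a => (p a).toReal) a := by
  rw [prob, PMF.toOuterMeasure_apply, ENNReal.tsum_toReal_eq]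
  · refine tsum_congr fun a => ?_
    by_cases h : a ∈ E <;> simp [h]
  · intro a
    exact ne_top_of_le_ne_top (p.apply_ne_top a) (Set.indicator_le_self _ _ a)

theorem prob_compl {α : Type*} (p : PMF α) (E : Set α) : prob p Eᶜ = 1 - prob p E := by
  have h1 : ∑' a, (p a).toReal = 1 := by
    rw [← ENNReal.tsum_toReal_eq p.apply_ne_top, p.tsum_coe, ENNReal.toReal_one]
  rw [eq_sub_iff_add_eq, prob_eq_tsum, prob_eq_tsum,
    ← ((summable_toReal p).indicator Eᶜ).tsum_add ((summable_toReal p).indicator E), ← h1]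
  exact tsum_congr fun a => Set.indicator_compl_add_self_apply E (fun a => (p a).toReal) a

theorem prob_map {α β : Type*} (f : α → β) (p : PMF α) (E : Set β) :
    prob (p.map f) E = prob p (f ⁻¹' E) := by
  rw [prob, PMF.toOuterMeasure_map_apply, prob]

theorem prob_bind_le {α β : Type*} (p : PMF α) (f : α → PMF β) (E : Set β) (B : Set α) {c : ℝ}
    (hc : 0 ≤ c) (h : ∀ a ∉ B, prob (f a) E ≤ c) : prob (p.bind f) E ≤ prob p B + c := by
  refine prob_le_of_toOuterMeasure_le (add_nonneg (prob_nonneg p B) hc) ?_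
  rw [ENNReal.ofReal_add (prob_nonneg p B) hc, ofReal_prob, PMF.toOuterMeasure_bind_apply,
    PMF.toOuterMeasure_apply]
  calc ∑' a, p a * (f a).toOuterMeasure E
      ≤ ∑' a, (B.indicator p a + p a * ENNReal.ofReal c) := by
        refine ENNReal.tsum_le_tsum fun a => ?_
        by_cases ha : a ∈ B
        · rw [Set.indicator_of_mem ha]
          exact (mul_le_of_le_one_right' (toOuterMeasure_le_one _ _)).trans le_self_add
        · rw [Set.indicator_of_notMem ha, zero_add, ← ofReal_prob]
          gcongr
          exact h a ha
    _ = ∑' a, B.indicator p a + ENNReal.ofReal c := by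
        rw [ENNReal.tsum_add, ENNReal.tsum_mul_right, p.tsum_coe, one_mul]

/-- The statistical distance bounds the difference of the probabilities of every event; the factor
`1 / 2` is recovered by also using the complementary event. -/
theorem prob_le_prob_add_statDist {α : Type*} (P Q : PMF α) (E : Set α) :
    prob P E ≤ prob Q E + statDist P Q := by
  have hd : Summable fun a => (P a).toReal - (Q a).toReal :=
    (summable_toReal P).sub (summable_toReal Q)
  have key : ∀ F : Set α, prob P F - prob Q F
      = ∑' a, F.indicator (fun a => (P a).toReal - (Q a).toReal) a := fun F => by
    rw [prob_eq_tsum, prob_eq_tsum,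
      ← ((summable_toReal P).indicator F).tsum_sub ((summable_toReal Q).indicator F)]
    exact tsum_congr fun a => by by_cases h : a ∈ F <;> simp [h]
  have h1 := key E
  have h2 := key Eᶜ
  rw [prob_compl, prob_compl] at h2
  have h3 : (prob P E - prob Q E) - ((1 - prob P E) - (1 - prob Q E))
      ≤ ∑' a, |(P a).toReal - (Q a).toReal| := by
    rw [h1, h2, ← (hd.indicator E).tsum_sub (hd.indicator Eᶜ)]
    refine ((hd.indicator E).sub (hd.indicator Eᶜ)).tsum_le_tsum (fun a => ?_) hd.abs
    by_cases h : a ∈ E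
    · simpa [h] using le_abs_self ((P a).toReal - (Q a).toReal)
    · simpa [h, abs_sub_comm] using neg_le_abs ((P a).toReal - (Q a).toReal)
  rw [statDist]
  linarith

theorem prob_independent_le : ∀ {k : ℕ} {α : Type*} (p : Fin k → PMF α) (B : Fin k → Set α),
    prob (independent p) {f | ∃ i, f i ∈ B i} ≤ ∑ i, prob (p i) (B i)
  | 0, _, p, B => by simp [prob]
  | k + 1, _, p, B => by
    rw [independent, Fin.sum_univ_succ]
    refine prob_bind_le _ _ _ _ (Finset.sum_nonneg fun i _ => prob_nonneg _ _) fun a ha => ?_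
    rw [prob_map]
    refine (prob_mono _ ?_).trans
      (prob_independent_le (fun i => p i.succ) fun i => B i.succ)
    rintro f ⟨i, hi⟩
    induction i using Fin.cases with
    | zero => exact absurd hi ha
    | succ i => exact ⟨i, hi⟩

/-! ### Tail bounds for discrete Gaussians on cosets -/

theorem tsum_gaussian_two_mul_le (σ : ℝ) (hσ : 0 < σ) :
    ∑' a : ℤ, Real.exp (-Real.pi * (a : ℝ) ^ 2 / (2 * σ) ^ 2) ≤ Real.exp (3 * (1 + σ)) := by
  set y : ℝ := Real.pi / (2 * σ) ^ 2 with hy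
  have hy0 : 0 < y := by positivity
  have hx1 : Real.exp (-y) < 1 := by rw [Real.exp_lt_one_iff]; linarith
  have hg := hasSum_geometric_of_lt_one (Real.exp_pos (-y)).le hx1
  have hle : ∀ (j : ℕ) (a : ℤ), (j : ℝ) ≤ (a : ℝ) ^ 2 →
      Real.exp (-Real.pi * (a : ℝ) ^ 2 / (2 * σ) ^ 2) ≤ Real.exp (-y) ^ j := fun j a h => by
    rw [← Real.exp_nat_mul]
    apply Real.exp_le_exp.mpr
    have h2 : -Real.pi * (a : ℝ) ^ 2 / (2 * σ) ^ 2 = -(y * (a : ℝ) ^ 2) := by rw [hy]; ring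
    rw [h2]
    nlinarith
  have hle1 : ∀ j : ℕ, Real.exp (-Real.pi * (((j : ℕ) : ℤ) : ℝ) ^ 2 / (2 * σ) ^ 2)
      ≤ Real.exp (-y) ^ j := fun j => hle j j (by exact_mod_cast Nat.le_self_pow (by norm_num) j)
  have hle2 : ∀ j : ℕ, Real.exp (-Real.pi * ((-((j : ℤ) + 1) : ℤ) : ℝ) ^ 2 / (2 * σ) ^ 2)
      ≤ Real.exp (-y) ^ j := fun j => hle j _ (by push_cast; nlinarith [(j.cast_nonneg : (0:ℝ) ≤ j)])
  have hs1 : Summable fun j : ℕ => Real.exp (-Real.pi * (((j : ℕ) : ℤ) : ℝ) ^ 2 / (2 * σ) ^ 2) :=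
    hg.summable.of_nonneg_of_le (fun _ => (Real.exp_pos _).le) hle1
  have hs2 : Summable fun j : ℕ =>
      Real.exp (-Real.pi * ((-((j : ℤ) + 1) : ℤ) : ℝ) ^ 2 / (2 * σ) ^ 2) :=
    hg.summable.of_nonneg_of_le (fun _ => (Real.exp_pos _).le) hle2
  rw [tsum_of_nat_of_neg_add_one (f := fun a : ℤ =>
    Real.exp (-Real.pi * (a : ℝ) ^ 2 / (2 * σ) ^ 2)) hs1 hs2]
  have b1 := hs1.tsum_le_tsum hle1 hg.summable
  have b2 := hs2.tsum_le_tsum hle2 hg.summable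
  rw [hg.tsum_eq] at b1 b2
  -- `1 / (1 - exp (-y)) ≤ 1 + 1 / y` follows from `1 + y ≤ exp y`.
  have b3 : (1 - Real.exp (-y))⁻¹ ≤ 1 + y⁻¹ := by
    have h1 : Real.exp (-y) ≤ (1 + y)⁻¹ := by
      rw [Real.exp_neg]
      exact inv_anti₀ (by positivity) (by linarith [Real.add_one_le_exp y])
    have h2 : y / (1 + y) ≤ 1 - Real.exp (-y) := by
      have : y / (1 + y) = 1 - (1 + y)⁻¹ := by field_simp; ring
      linarith
    calc (1 - Real.exp (-y))⁻¹ ≤ (y / (1 + y))⁻¹ := inv_anti₀ (by positivity) h2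
      _ = 1 + y⁻¹ := by field_simp; ring
  have b4 : y⁻¹ ≤ 4 * σ ^ 2 / 3 := by
    rw [hy, inv_div, mul_pow, div_le_div_iff₀ Real.pi_pos (by norm_num)]
    nlinarith [Real.pi_gt_three, sq_nonneg σ]
  have b5 := Real.quadratic_le_exp_of_nonneg (x := 3 * (1 + σ)) (by positivity)
  nlinarith

theorem tsum_gaussianWeight_two_mul_le (σ : ℝ) (hσ : 0 < σ) (k : ℕ) :
    ∑' x : Fin k → ℤ, gaussianWeight (2 * σ) x ≤ ENNReal.ofReal (Real.exp (3 * (1 + σ) * k)) := by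
  induction k with
  | zero => simp [gaussianWeight]
  | succ k ih =>
    rw [← (Fin.consEquiv fun _ : Fin (k + 1) => ℤ).tsum_eq, ENNReal.tsum_prod']
    simp only [Fin.consEquiv, Equiv.coe_fn_mk, gaussianWeight_cons, ENNReal.tsum_mul_left,
      ENNReal.tsum_mul_right]
    rw [← ENNReal.ofReal_tsum_of_nonneg (fun a => (Real.exp_pos _).le)
      (summable_gaussian_int (2 * σ) (by positivity))]
    refine (mul_le_mul' (ENNReal.ofReal_le_ofReal (tsum_gaussian_two_mul_le σ hσ)) ih).trans ?_
    rw [← ENNReal.ofReal_mul (Real.exp_pos _).le, ← Real.exp_add]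
    refine le_of_eq ?_
    push_cast
    ring_nf

theorem gaussianWeight_le_two_mul (σ : ℝ) {k : ℕ} (x : Fin k → ℤ) {T : ℝ}
    (hx : T ≤ ∑ i, (x i : ℝ) ^ 2) :
    gaussianWeight σ x
      ≤ ENNReal.ofReal (Real.exp (-(3 * Real.pi / 4 * T / σ ^ 2))) * gaussianWeight (2 * σ) x := by
  rw [gaussianWeight, gaussianWeight, ← ENNReal.ofReal_mul (Real.exp_pos _).le, ← Real.exp_add]
  refine ENNReal.ofReal_le_ofReal (Real.exp_le_exp.mpr ?_)
  have h : 3 * Real.pi / 4 * T / σ ^ 2 ≤ 3 * Real.pi / 4 * (∑ i, (x i : ℝ) ^ 2) / σ ^ 2 := by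
    gcongr
  have h2 : -Real.pi * (∑ i, (x i : ℝ) ^ 2) / (2 * σ) ^ 2
      = -(Real.pi * (∑ i, (x i : ℝ) ^ 2) / σ ^ 2) / 4 := by ring
  have h3 : 3 * Real.pi / 4 * (∑ i, (x i : ℝ) ^ 2) / σ ^ 2
      = 3 / 4 * (Real.pi * (∑ i, (x i : ℝ) ^ 2) / σ ^ 2) := by ring
  have h4 : -Real.pi * (∑ i, (x i : ℝ) ^ 2) / σ ^ 2
      = -(Real.pi * (∑ i, (x i : ℝ) ^ 2) / σ ^ 2) := by ring
  rw [h2, h4]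
  linarith

/-- A discrete Gaussian on an arbitrary set of integer vectors that contains a short vector `r` is
short with overwhelming probability, for every width `σ`. No bound on the smoothing parameter is
needed: the total weight is at least that of `r`, and the tail is compared with the Gaussian of
width `2 σ` on all of `ℤ^k`. -/
theorem prob_discreteGaussian_tail_le {k : ℕ} (Λ : Set (Fin k → ℤ)) (hΛ : Λ.Nonempty) (σ : ℝ)
    (hσ : 0 < σ) {r : Fin k → ℤ} (hr : r ∈ Λ) {T : ℝ}
    (hT : 2 * ∑ i, (r i : ℝ) ^ 2 + 2 * σ ^ 2 * k * (1 + σ) ≤ T) :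
    prob (discreteGaussian Λ hΛ σ hσ) {x | T < ∑ i, (x i : ℝ) ^ 2} ≤ Real.exp (-k) := by
  refine prob_le_of_toOuterMeasure_le (Real.exp_pos _).le ?_
  set W := ∑' x, Λ.indicator (gaussianWeight σ) x with hW
  have hWr : gaussianWeight σ r ≤ W := by
    have := ENNReal.le_tsum (f := Λ.indicator (gaussianWeight σ)) r
    rwa [Set.indicator_of_mem hr] at this
  rw [PMF.toOuterMeasure_apply]
  calc ∑' x, {x | T < ∑ i, (x i : ℝ) ^ 2}.indicator (discreteGaussian Λ hΛ σ hσ) x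
      ≤ ∑' x, ENNReal.ofReal (Real.exp (-(3 * Real.pi / 4 * T / σ ^ 2)))
          * gaussianWeight (2 * σ) x * W⁻¹ := by
        refine ENNReal.tsum_le_tsum fun x => ?_
        by_cases hx : x ∈ {x : Fin k → ℤ | T < ∑ i, (x i : ℝ) ^ 2}
        · rw [Set.indicator_of_mem hx, discreteGaussian, PMF.normalize_apply]
          gcongr
          exact (Set.indicator_le_self _ _ x).trans
            (gaussianWeight_le_two_mul σ x (le_of_lt hx))
        · rw [Set.indicator_of_notMem hx]
          exact zero_le
    _ = ENNReal.ofReal (Real.exp (-(3 * Real.pi / 4 * T / σ ^ 2)))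
          * (∑' x : Fin k → ℤ, gaussianWeight (2 * σ) x) * W⁻¹ := by
        rw [ENNReal.tsum_mul_right, ENNReal.tsum_mul_left]
    _ ≤ ENNReal.ofReal (Real.exp (-(3 * Real.pi / 4 * T / σ ^ 2)))
          * ENNReal.ofReal (Real.exp (3 * (1 + σ) * k)) * (gaussianWeight σ r)⁻¹ := by
        gcongr
        exact tsum_gaussianWeight_two_mul_le σ hσ k
    _ ≤ ENNReal.ofReal (Real.exp (-k)) := by
        rw [gaussianWeight, ← ENNReal.ofReal_inv_of_pos (Real.exp_pos _),
          ← ENNReal.ofReal_mul (Real.exp_pos _).le, ← ENNReal.ofReal_mul (by positivity),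
          ← Real.exp_neg, ← Real.exp_add, ← Real.exp_add]
        refine ENNReal.ofReal_le_ofReal (Real.exp_le_exp.mpr ?_)
        set R := ∑ i, (r i : ℝ) ^ 2 with hR
        have hR0 : 0 ≤ R := Finset.sum_nonneg fun i _ => sq_nonneg _
        have h1 : 3 * Real.pi / 4 * (2 * R + 2 * σ ^ 2 * k * (1 + σ)) / σ ^ 2
            ≤ 3 * Real.pi / 4 * T / σ ^ 2 := by gcongr
        have h2 : 3 * Real.pi / 4 * (2 * R + 2 * σ ^ 2 * k * (1 + σ)) / σ ^ 2
            = 3 / 2 * (Real.pi * R / σ ^ 2) + 3 / 2 * Real.pi * (k * (1 + σ)) := by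
          field_simp
          ring
        have h3 : -(-Real.pi * R / σ ^ 2) = Real.pi * R / σ ^ 2 := by ring
        have h4 : 0 ≤ Real.pi * R / σ ^ 2 := by positivity
        have h5 : (k : ℝ) ≤ k * (1 + σ) := by
          nlinarith [(k.cast_nonneg : (0 : ℝ) ≤ k)]
        have h6 : 0 ≤ (Real.pi - 3) * (k * (1 + σ)) :=
          mul_nonneg (by linarith [Real.pi_gt_three]) (by positivity)
        rw [h3]
        nlinarith

theorem prob_discreteGaussian_notMem {k : ℕ} (Λ : Set (Fin k → ℤ)) (hΛ : Λ.Nonempty) (σ : ℝ)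
    (hσ : 0 < σ) : prob (discreteGaussian Λ hΛ σ hσ) Λᶜ = 0 := by
  rw [prob, PMF.toOuterMeasure_apply]
  have : ∀ x, Λᶜ.indicator (discreteGaussian Λ hΛ σ hσ) x = 0 := fun x => by
    by_cases hx : x ∈ Λ
    · simp [hx]
    · simp [hx, discreteGaussian, PMF.normalize_apply]
  simp [this]

/-! ### Short preimages under uniform matrices -/

/-- Universal hashing: if distinct elements of `B` collide under at most a `1 / |Y|` fraction of the
keys, then the fraction of keys under which `B` fails to cover `Y` is at most `|Y|² / |B|`. This is
Chebyshev's inequality: such a key contributes at least `|B|²` to the variance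
`∑ k y, (|Y| N k y - |B|)²`, where `N k y` is the number of preimages of `y` in `B`. -/
theorem card_not_covering_mul_le {K X Y : Type*} [Fintype K] [Fintype Y] [DecidableEq X]
    [DecidableEq Y] (h : K → X → Y) (B : Finset X)
    (hcol : ∀ r ∈ B, ∀ r' ∈ B, r ≠ r' →
      Fintype.card Y * (Finset.univ.filter fun k => h k r = h k r').card ≤ Fintype.card K)
    (S : Finset K) (hS : ∀ k ∈ S, ∃ y, ∀ r ∈ B, h k r ≠ y) :
    S.card * B.card ≤ Fintype.card Y ^ 2 * Fintype.card K := by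
  rcases B.eq_empty_or_nonempty with rfl | hB
  · simp
  set N : K → Y → ℕ := fun k y => (B.filter fun r => h k r = y).card with hN
  obtain ⟨b, hb⟩ : ∃ b : ℤ, b = B.card := ⟨_, rfl⟩
  obtain ⟨p, hp⟩ : ∃ p : ℤ, p = Fintype.card Y := ⟨_, rfl⟩
  obtain ⟨M, hM⟩ : ∃ M : ℤ, M = Fintype.card K := ⟨_, rfl⟩
  have hp0 : 0 ≤ p := by rw [hp]; positivity
  have hM0 : 0 ≤ M := by rw [hM]; positivity
  have hb0 : 0 < b := by rw [hb]; exact_mod_cast hB.card_pos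
  have hsum : ∀ k, ∑ y, (N k y : ℤ) = b := fun k => by
    rw [hb, Finset.card_eq_sum_card_fiberwise (f := h k) (t := Finset.univ) (by simp)]
    push_cast
    rfl
  have hsq : ∀ k, ∑ y, (N k y : ℤ) ^ 2
      = ∑ r ∈ B, ∑ r' ∈ B, if h k r = h k r' then 1 else 0 := fun k => by
    have : ∀ y, (N k y : ℤ) ^ 2
        = ∑ r ∈ B, ∑ r' ∈ B, if h k r = y then (if h k r' = y then 1 else 0) else 0 := fun y => by
      simp only [hN, Finset.card_filter, sq]
      push_cast
      rw [Finset.sum_mul_sum]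
      refine Finset.sum_congr rfl fun r _ => Finset.sum_congr rfl fun r' _ => ?_
      split_ifs <;> simp
    simp only [this]
    rw [Finset.sum_comm]
    refine Finset.sum_congr rfl fun r _ => ?_
    rw [Finset.sum_comm]
    refine Finset.sum_congr rfl fun r' _ => ?_
    rw [Finset.sum_ite_eq Finset.univ (h k r)]
    simp [eq_comm]
  have hcolsum : p * ∑ k, ∑ y, (N k y : ℤ) ^ 2 ≤ p * b * M + b * b * M := by
    have h1 : ∑ k, ∑ y, (N k y : ℤ) ^ 2
        = ∑ r ∈ B, ∑ r' ∈ B, ((Finset.univ.filter fun k => h k r = h k r').card : ℤ) := by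
      simp only [hsq]
      rw [Finset.sum_comm]
      refine Finset.sum_congr rfl fun r _ => ?_
      rw [Finset.sum_comm]
      refine Finset.sum_congr rfl fun r' _ => ?_
      rw [Finset.card_filter]
      push_cast
      rfl
    have h2 : ∀ r ∈ B, ∑ r' ∈ B, p * ((Finset.univ.filter fun k => h k r = h k r').card : ℤ)
        ≤ p * M + b * M := fun r hr => by
      rw [← Finset.add_sum_erase B _ hr]
      refine add_le_add ?_ ?_
      · rw [hM, ← Finset.card_univ]
        simp
      · refine (Finset.sum_le_card_nsmul _ _ M fun r' hr' => ?_).trans ?_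
        · have := hcol r hr r' (Finset.mem_of_mem_erase hr') (Finset.ne_of_mem_erase hr').symm
          rw [hp, hM]
          exact_mod_cast this
        · rw [nsmul_eq_mul]
          have : ((B.erase r).card : ℤ) ≤ b := by
            rw [hb]
            exact_mod_cast Finset.card_erase_le
          exact mul_le_mul_of_nonneg_right this hM0
    rw [h1, Finset.mul_sum]
    simp only [Finset.mul_sum]
    refine (Finset.sum_le_card_nsmul B _ _ h2).trans (le_of_eq ?_)
    rw [nsmul_eq_mul, ← hb]
    ring
  have hvar : ∑ k, ∑ y, (p * (N k y : ℤ) - b) ^ 2 ≤ p ^ 2 * b * M := by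
    have h1 : ∀ k, ∑ y, (p * (N k y : ℤ) - b) ^ 2
        = p ^ 2 * (∑ y, (N k y : ℤ) ^ 2) - p * b ^ 2 := fun k => by
      have : ∀ y, (p * (N k y : ℤ) - b) ^ 2
          = p ^ 2 * (N k y : ℤ) ^ 2 - 2 * p * b * N k y + b ^ 2 := fun y => by ring
      simp only [this, Finset.sum_add_distrib, Finset.sum_sub_distrib, ← Finset.mul_sum, hsum,
        Finset.sum_const, Finset.card_univ, nsmul_eq_mul, ← hp]
      ring
    simp only [h1, Finset.sum_sub_distrib, ← Finset.mul_sum, Finset.sum_const, Finset.card_univ,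
      nsmul_eq_mul, ← hM]
    nlinarith [hcolsum, hp0]
  have hbad : (S.card : ℤ) * b ^ 2 ≤ ∑ k, ∑ y, (p * (N k y : ℤ) - b) ^ 2 := by
    have h1 : ∀ k ∈ S, b ^ 2 ≤ ∑ y, (p * (N k y : ℤ) - b) ^ 2 := fun k hk => by
      obtain ⟨y, hy⟩ := hS k hk
      have hy0 : N k y = 0 := by
        rw [hN]
        simpa [Finset.filter_eq_empty_iff] using hy
      calc b ^ 2 = (p * (N k y : ℤ) - b) ^ 2 := by rw [hy0]; ring
        _ ≤ _ := Finset.single_le_sum (f := fun y => (p * (N k y : ℤ) - b) ^ 2)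
            (fun _ _ => sq_nonneg _) (Finset.mem_univ y)
    have h2 := Finset.card_nsmul_le_sum S _ _ h1
    rw [nsmul_eq_mul] at h2
    exact h2.trans (Finset.sum_le_sum_of_subset_of_nonneg (Finset.subset_univ S)
      fun k _ _ => Finset.sum_nonneg fun y _ => sq_nonneg _)
  have hfin : (S.card : ℤ) * b ≤ p ^ 2 * M := by
    refine le_of_mul_le_mul_right ?_ hb0
    calc (S.card : ℤ) * b * b = S.card * b ^ 2 := by ring
      _ ≤ p ^ 2 * b * M := hbad.trans hvar
      _ = p ^ 2 * M * b := by ring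
  rw [hb, hp, hM] at hfin
  exact_mod_cast hfin

theorem card_mulVec_eq_mul {q n m : ℕ} [Fact q.Prime] (r r' : Fin m → ZMod q) (hr : r ≠ r') :
    Fintype.card (Fin n → ZMod q) * (Finset.univ.filter
      fun A : Matrix (Fin n) (Fin m) (ZMod q) => A.mulVec r = A.mulVec r').card
      = Fintype.card (Matrix (Fin n) (Fin m) (ZMod q)) := by
  classical
  obtain ⟨j, hj⟩ := Function.ne_iff.mp hr
  have hz : r j - r' j ≠ 0 := sub_ne_zero.mpr hj
  let f : Matrix (Fin n) (Fin m) (ZMod q) →+ (Fin n → ZMod q) :=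
    { toFun := fun A => A.mulVec (r - r')
      map_zero' := Matrix.zero_mulVec _
      map_add' := fun A B => Matrix.add_mulVec A B _ }
  have hf : Function.Surjective f := fun u => by
    refine ⟨Matrix.of fun i k => if k = j then u i * (r j - r' j)⁻¹ else 0, ?_⟩
    funext i
    change ∑ k, (if k = j then u i * (r j - r' j)⁻¹ else 0) * (r - r') k = u i
    simp [ite_mul, mul_assoc, inv_mul_cancel₀ hz]
  have hfib : ∀ u, (Finset.univ.filter fun A => f A = u).card
      = (Finset.univ.filter fun A => f A = 0).card := fun u =>
    AddMonoidHom.card_fiber_eq_of_mem_range f (hf u) (hf 0)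
  have hker : (Finset.univ.filter fun A : Matrix (Fin n) (Fin m) (ZMod q) =>
      A.mulVec r = A.mulVec r') = Finset.univ.filter fun A => f A = 0 := by
    ext A
    simp only [Finset.mem_filter, Finset.mem_univ, true_and]
    change _ ↔ A.mulVec (r - r') = 0
    rw [Matrix.mulVec_sub, sub_eq_zero]
  rw [hker, ← Finset.card_univ (α := Matrix (Fin n) (Fin m) (ZMod q)),
    Finset.card_eq_sum_card_fiberwise (s := Finset.univ) (f := f) (t := Finset.univ) (by simp)]
  simp [hfib]

/-- All but a `q ^ (2 n) / b ^ m` fraction of the matrices `A` map the integer box `[0, b)^m` onto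
`ℤ_q^n`. -/
theorem prob_uniform_no_short_syndrome_le {q n m b : ℕ} [Fact q.Prime] (hb0 : 0 < b) (hb : b ≤ q) :
    prob (PMF.uniformOfFintype (Matrix (Fin n) (Fin m) (ZMod q)))
      {A | ¬ ∀ u, ∃ r ∈ syndromes A u, ∀ i, 0 ≤ r i ∧ r i < b} ≤ (q : ℝ) ^ (2 * n) / (b : ℝ) ^ m := by
  classical
  let B : Finset (Fin m → ZMod q) :=
    Fintype.piFinset fun _ => (Finset.range b).image (Nat.cast : ℕ → ZMod q)
  have hBcard : B.card = b ^ m := by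
    rw [Fintype.card_piFinset, Finset.prod_const, Finset.card_image_of_injOn, Finset.card_range,
      Finset.card_univ, Fintype.card_fin]
    intro a ha a' ha' h
    have h' := congrArg ZMod.val h
    simp only [Finset.coe_range, Set.mem_Iio] at ha ha'
    rwa [ZMod.val_natCast, ZMod.val_natCast, Nat.mod_eq_of_lt (ha.trans_le hb),
      Nat.mod_eq_of_lt (ha'.trans_le hb)] at h'
  set E : Set (Matrix (Fin n) (Fin m) (ZMod q)) :=
    {A | ¬ ∀ u, ∃ r ∈ syndromes A u, ∀ i, 0 ≤ r i ∧ r i < b} with hE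
  have hcount := card_not_covering_mul_le
    (fun (A : Matrix (Fin n) (Fin m) (ZMod q)) r => A.mulVec r) B
    (fun r _ r' _ hr => (card_mulVec_eq_mul r r' hr).le) E.toFinset (by
      intro A hA
      rw [Set.mem_toFinset, hE, Set.mem_ofPred_eq] at hA
      push Not at hA
      obtain ⟨u, hu⟩ := hA
      refine ⟨u, fun r hr hAr => ?_⟩
      have hr' : ∀ i, ∃ a < b, ((a : ℕ) : ZMod q) = r i := by
        simpa [B, Fintype.mem_piFinset] using hr
      choose a ha har using hr'
      obtain ⟨i, hi⟩ := hu (fun i => (a i : ℤ)) (by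
        change A.mulVec (modVec q fun i => (a i : ℤ)) = u
        rw [← hAr]
        congr 1
        funext i
        simp [modVec, har])
      have := hi (by positivity)
      have := ha i
      omega)
  rw [prob, PMF.toOuterMeasure_uniformOfFintype_apply, ENNReal.toReal_div, ENNReal.toReal_natCast,
    ENNReal.toReal_natCast, ← Set.toFinset_card]
  rw [hBcard, Fintype.card_fun, ZMod.card, Fintype.card_fin] at hcount
  rw [div_le_div_iff₀ (by exact_mod_cast Fintype.card_pos) (by positivity)]
  have : ((E.toFinset.card * b ^ m : ℕ) : ℝ)
      ≤ (((q ^ n) ^ 2 * Fintype.card (Matrix (Fin n) (Fin m) (ZMod q)) : ℕ) : ℝ) := by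
    exact_mod_cast hcount
  push_cast at this
  rw [← pow_mul, mul_comm n 2] at this
  exact this

/-! ### The decryption network on basis states -/

/-- The basis state of one coordinate reached from `r` by the ten decryption networks. -/
def decryptBasis (q : ℕ) (r : Bool × Aux q) : Bool × Aux q :=
  (copyHalf q).symm ((addCopy q).symm (copyHalf q (addKey q ((subHalf q).symm
    ((absWork q).symm (compareQuarter q (absWork q (subHalf q ((addKey q).symm r)))))))))

theorem toNat_encodeZMod {q : ℕ} [NeZero q] (a : ZMod q) : (encodeZMod a).toNat = a.val := by
  rw [encodeZMod, BitVec.toNat_ofNat,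
    Nat.mod_eq_of_lt ((ZMod.val_lt a).trans (lt_two_pow_regLen q))]

theorem ofNat_regLen_succ {q : ℕ} [NeZero q] (a : ZMod q) :
    BitVec.ofNat (regLen q + 1) a.val = (encodeZMod a).setWidth (regLen q + 1) := by
  apply BitVec.eq_of_toNat_eq
  simp [BitVec.toNat_setWidth, toNat_encodeZMod]

/-- On representatives of residues, the inverse of the modular adder subtracts in `ℤ_q`. -/
theorem modAdd_symm_encodeZMod {q : ℕ} [NeZero q] (a c : ZMod q) :
    (modAdd q (encodeZMod a)).symm ((encodeZMod c).setWidth (regLen q + 1))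
      = (encodeZMod (c - a)).setWidth (regLen q + 1) := by
  have hq : q < 2 ^ (regLen q + 1) :=
    (lt_two_pow_regLen q).trans (Nat.pow_lt_pow_right (by norm_num) (Nat.lt_succ_self _))
  have ha := ZMod.val_lt a
  have hc := ZMod.val_lt c
  have h1 : ((encodeZMod c).setWidth (regLen q + 1)).toNat = c.val := by
    rw [BitVec.toNat_setWidth, toNat_encodeZMod, Nat.mod_eq_of_lt (hc.trans hq)]
  have h2 : (c.val + (q - a.val)) % q = (c - a).val := by
    rw [← ZMod.val_natCast]
    congr 1
    rw [Nat.cast_add, Nat.cast_sub ha.le]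
    simp [sub_eq_add_neg]
  change (if _ then _ else _) = _
  rw [h1, toNat_encodeZMod, if_pos ⟨ha, hc⟩, h2, ofNat_regLen_succ]

/-- Subtracting `h` from `w` and taking the absolute value yields `|w - h|` below the sign
qubit. -/
theorem toNat_absNet_subNet {ℓ : ℕ} (h w : BitVec ℓ) :
    ((absNet ℓ (subNet h (w.setWidth (ℓ + 1)))).setWidth ℓ).toNat
      = (w.toNat - h.toNat) + (h.toNat - w.toNat) := by
  have hh := h.isLt
  have hw := w.isLt
  have hp : 2 ^ (ℓ + 1) = 2 * 2 ^ ℓ := by ring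
  have e1 : h.toNat % (2 * 2 ^ ℓ) = h.toNat := Nat.mod_eq_of_lt (by omega)
  have e2 : w.toNat % (2 * 2 ^ ℓ) = w.toNat := Nat.mod_eq_of_lt (by omega)
  have hs : (w.setWidth (ℓ + 1) - h.setWidth (ℓ + 1)).toNat
      = if h.toNat ≤ w.toNat then w.toNat - h.toNat else 2 * 2 ^ ℓ - h.toNat + w.toNat := by
    rw [BitVec.toNat_sub, BitVec.toNat_setWidth, BitVec.toNat_setWidth, hp, e1, e2]
    split_ifs with hle
    · rw [show 2 * 2 ^ ℓ - h.toNat + w.toNat = w.toNat - h.toNat + 2 * 2 ^ ℓ by omega,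
        Nat.add_mod_right, Nat.mod_eq_of_lt (by omega)]
    · exact Nat.mod_eq_of_lt (by omega)
  change ((if (w.setWidth (ℓ + 1) - h.setWidth (ℓ + 1)).msb then _ else _ :
    BitVec (ℓ + 1)).setWidth ℓ).toNat = _
  rw [BitVec.msb_eq_decide, Nat.add_sub_cancel, hs]
  by_cases hle : h.toNat ≤ w.toNat
  · have : ¬ 2 ^ ℓ ≤ w.toNat - h.toNat := by omega
    simp only [hle, if_true, this, decide_false, Bool.false_eq_true, if_false]
    change ((w.setWidth (ℓ + 1) - h.setWidth (ℓ + 1)).setWidth ℓ).toNat = _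
    rw [BitVec.toNat_setWidth, hs, if_pos hle, Nat.mod_eq_of_lt (by omega)]
    omega
  · have : 2 ^ ℓ ≤ 2 * 2 ^ ℓ - h.toNat + w.toNat := by omega
    simp only [hle, if_false, this, decide_true, if_true]
    change ((BitVec.cons true (~~~((w.setWidth (ℓ + 1) - h.setWidth (ℓ + 1)).setWidth ℓ)
      + 1#ℓ)).setWidth ℓ).toNat = _
    rw [BitVec.setWidth_cons, ← BitVec.neg_eq_not_add, BitVec.toNat_neg, BitVec.toNat_setWidth,
      hs, if_neg hle,
      show 2 * 2 ^ ℓ - h.toNat + w.toNat = 2 ^ ℓ - h.toNat + w.toNat + 2 ^ ℓ by omega,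
      Nat.add_mod_right, Nat.mod_eq_of_lt (a := 2 ^ ℓ - h.toNat + w.toNat) (by omega),
      Nat.mod_eq_of_lt (by omega)]
    omega

/-- The comparison reads off the message bit from `v + ⌊q/2⌋ μ` as soon as `|v| < ⌊q/4⌋`. -/
theorem natDist_half_lt_quarter_iff {q : ℕ} [NeZero q] (v : ℤ) (hv : |v| < ((q / 4 : ℕ) : ℤ))
    (μ : Bool) (w : ℕ) (hw : w = ((v : ZMod q) + ((q / 2 : ℕ) : ZMod q) * (if μ then 1 else 0)).val) :
    (w - q / 2) + (q / 2 - w) < q / 4 ↔ μ = true := by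
  have hval : ∀ z : ℤ, ((((z : ZMod q)).val : ℕ) : ℤ) = z % q := fun z => ZMod.val_intCast z
  rw [abs_lt] at hv
  have h : (w : ℤ) = (v + ((q / 2 : ℕ) : ℤ) * (if μ then 1 else 0)) % q := by
    rw [hw, ← hval, Int.cast_add, Int.cast_mul, Int.cast_natCast]
    cases μ <;> simp
  cases μ with
  | true =>
    simp only [if_true, mul_one] at h
    rw [Int.emod_eq_of_lt (by omega) (by omega)] at h
    simp only [iff_true]
    omega
  | false =>
    simp only [Bool.false_eq_true, if_false, mul_zero, add_zero] at h
    simp only [Bool.false_eq_true, iff_false, not_lt]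
    by_cases h0 : 0 ≤ v
    · rw [Int.emod_eq_of_lt (by omega) (by omega)] at h
      omega
    · rw [← Int.add_emod_right, Int.emod_eq_of_lt (by omega) (by omega)] at h
      omega

theorem onWork_apply {q : ℕ} (f : Aux q → Equiv.Perm (BitVec (regLen q + 1)))
    (hf : ∀ (r : Aux q) (w : BitVec (regLen q + 1)), f { r with work := w } = f r)
    (r : Bool × Aux q) : onWork f hf r = (r.1, { r.2 with work := f r.2 r.2.work }) := rfl

theorem onWork_symm_apply {q : ℕ} (f : Aux q → Equiv.Perm (BitVec (regLen q + 1)))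
    (hf : ∀ (r : Aux q) (w : BitVec (regLen q + 1)), f { r with work := w } = f r)
    (r : Bool × Aux q) :
    (onWork f hf).symm r = (r.1, { r.2 with work := (f r.2).symm r.2.work }) := rfl

theorem compareQuarter_apply {q : ℕ} (r : Bool × Aux q) : compareQuarter q r
    = (r.1 ^^ decide ((r.2.work.setWidth (regLen q)).toNat < r.2.quarter.toNat), r.2) := rfl

theorem copyHalf_apply {q : ℕ} (r : Bool × Aux q) : copyHalf q r = (r.1, { r.2 with
    copy := r.2.copy ^^^ (if r.1 then BitVec.ofNat (regLen q) (q / 2) else 0#(regLen q)) }) := rfl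

theorem copyHalf_symm_apply {q : ℕ} (r : Bool × Aux q) :
    (copyHalf q).symm r = copyHalf q r := rfl

theorem encodeZMod_half {q : ℕ} [NeZero q] (μ : Bool) :
    (if μ then BitVec.ofNat (regLen q) (q / 2) else 0#(regLen q))
      = encodeZMod (((q / 2 : ℕ) : ZMod q) * (if μ then 1 else 0)) := by
  have hlt : q / 2 < q := Nat.div_lt_self (NeZero.pos q) (by norm_num)
  cases μ
  · simp [encodeZMod]
  · simp [encodeZMod, ZMod.val_natCast, Nat.mod_eq_of_lt hlt]

/-- One coordinate of decryption on a basis state: if `x - y` is a small residue, the message bit is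
moved to the message qubit and the work register returns to `x`. -/
theorem decryptBasis_auxWith {q : ℕ} [NeZero q] (x y : ZMod q) (v : ℤ)
    (hv : |v| < ((q / 4 : ℕ) : ℤ)) (hxy : x - y = (v : ZMod q)) (μ : Bool) :
    decryptBasis q (false, auxWith y
        (encodeZMod (x + ((q / 2 : ℕ) : ZMod q) * (if μ then 1 else 0))))
      = (μ, auxWith y (encodeZMod x)) := by
  have hq2 : q / 2 < 2 ^ regLen q := (Nat.div_le_self q 2).trans_lt (lt_two_pow_regLen q)
  have hq4 : q / 4 < 2 ^ regLen q := (Nat.div_le_self q 4).trans_lt (lt_two_pow_regLen q)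
  have hbit : decide (((absNet (regLen q) (subNet (BitVec.ofNat (regLen q) (q / 2))
      ((modAdd q (encodeZMod y)).symm ((encodeZMod (x + ((q / 2 : ℕ) : ZMod q) *
        (if μ then 1 else 0))).setWidth (regLen q + 1))))).setWidth (regLen q)).toNat
          < (BitVec.ofNat (regLen q) (q / 4)).toNat) = μ := by
    rw [modAdd_symm_encodeZMod, toNat_absNet_subNet, BitVec.toNat_ofNat, BitVec.toNat_ofNat,
      Nat.mod_eq_of_lt hq2, Nat.mod_eq_of_lt hq4, toNat_encodeZMod, add_sub_right_comm, hxy,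
      Bool.eq_iff_iff, decide_eq_true_iff]
    exact natDist_half_lt_quarter_iff v hv μ _ rfl
  simp only [decryptBasis, addKey, subHalf, absWork, addCopy, onWork_apply, onWork_symm_apply,
    compareQuarter_apply, copyHalf_symm_apply, copyHalf_apply, auxWith, Equiv.symm_apply_apply,
    Equiv.apply_symm_apply, hbit, Bool.false_xor, BitVec.zero_xor, BitVec.xor_self]
  rw [encodeZMod_half, modAdd_symm_encodeZMod, add_sub_cancel_right]

/-! ### Linearity: from basis states to superpositions -/

theorem unitaryOf_ket {B : Type} [Fintype B] (p : Equiv.Perm B) (b : B) :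
    unitaryOf p (ket b) = ket (p b) := by
  classical
  rw [unitaryOf, ket, ket]
  convert LinearIsometryEquiv.piLpCongrLeft_single p b (1 : ℂ) using 2

theorem tensor_ket_ket {B C : Type} [Fintype B] [Fintype C] (b : B) (c : C) :
    tensor (ket b) (ket c) = ket (b, c) := by
  ext ⟨b', c'⟩
  simp only [tensor, ket, PiLp.single_apply, Prod.mk.injEq]
  by_cases h1 : b' = b <;> by_cases h2 : c' = c <;> simp [h1, h2]

theorem tensor_sum_smul_right {B C ι : Type} [Fintype B] [Fintype C] (φ : State B) (s : Finset ι)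
    (a : ι → ℂ) (χ : ι → State C) :
    tensor φ (∑ i ∈ s, a i • χ i) = ∑ i ∈ s, a i • tensor φ (χ i) := by
  ext p
  simp only [tensor, WithLp.ofLp_sum, WithLp.ofLp_smul, Finset.sum_apply, Pi.smul_apply,
    smul_eq_mul, Finset.mul_sum]
  exact Finset.sum_congr rfl fun i _ => by ring

theorem sum_smul_tensor_ket {B C : Type} [Fintype B] [Fintype C] (φ : State B) (c : C) :
    ∑ b, φ b • tensor (ket b) (ket c) = tensor φ (ket c) := by
  classical
  ext p
  simp only [tensor, WithLp.ofLp_sum, WithLp.ofLp_smul, Finset.sum_apply, Pi.smul_apply,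
    smul_eq_mul, ket, PiLp.single_apply]
  rw [Finset.sum_eq_single p.1]
  · simp
  · intro b _ hb
    simp [hb.symm]
  · simp

theorem load_sum_ket {n q : ℕ} (y : Fin n → ZMod q) {ι : Type} (s : Finset ι) (a : ι → ℂ)
    (c : ι → Fin n → BitVec (regLen q)) :
    load y (∑ i ∈ s, a i • ket (c i)) = ∑ i ∈ s, a i • ket fun j => auxWith (y j) (c i j) := by
  classical
  simp only [load, WithLp.ofLp_sum, WithLp.ofLp_smul, Finset.sum_apply, Pi.smul_apply,
    Finset.sum_smul, smul_eq_mul]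
  rw [Finset.sum_comm]
  refine Finset.sum_congr rfl fun i _ => ?_
  rw [Finset.sum_eq_single (c i)]
  · simp [ket]
  · intro b _ hb
    simp [ket, hb]
  · simp

theorem decryptU_ket {n q : ℕ} (b : Fin n → Bool) (a : Fin n → Aux q) :
    decryptU n q (ket (b, a))
      = ket (fun i => (decryptBasis q (b i, a i)).1, fun i => (decryptBasis q (b i, a i)).2) := by
  simp only [decryptU, LinearIsometryEquiv.trans_apply, stepU, unitaryOf_ket]
  rfl

/-- Decryption is correct if every coordinate of the noise `x - y` has a representative of absolute
value less than `⌊q/4⌋`. -/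
theorem qDecrypt_cipherState {n m q : ℕ} [NeZero q] (R : Matrix (Fin m) (Fin n) ℤ)
    (c₁ : Fin m → ZMod q) (x : Fin n → ZMod q) (v : Fin n → ℤ)
    (hv : ∀ i, |v i| < ((q / 4 : ℕ) : ℤ))
    (hx : ∀ i, x i - (R.map (Int.cast : ℤ → ZMod q)).transpose.mulVec c₁ i = (v i : ZMod q))
    (α : State (Fin n → Bool)) :
    qDecrypt R c₁ (cipherState x α) = tensor α (ket fun i =>
      auxWith ((R.map (Int.cast : ℤ → ZMod q)).transpose.mulVec c₁ i) (encodeZMod (x i))) := by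
  rw [qDecrypt, cipherState, load_sum_ket, tensor_sum_smul_right, map_sum, ← sum_smul_tensor_ket]
  refine Finset.sum_congr rfl fun μ _ => ?_
  rw [map_smul, tensor_ket_ket, decryptU_ket, tensor_ket_ket]
  congr 2
  ext1
  · funext i
    simp only [decryptBasis_auxWith _ _ _ (hv i) (hx i)]
  · funext i
    simp only [decryptBasis_auxWith _ _ _ (hv i) (hx i)]

/-! ### Correctness for short keys and short noise -/

theorem abs_le_sqrt_of_sum_sq_le {k : ℕ} (v : Fin k → ℤ) {t : ℝ} (h : ∑ i, (v i : ℝ) ^ 2 ≤ t)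
    (i : Fin k) : |(v i : ℝ)| ≤ Real.sqrt t := by
  rw [← Real.sqrt_sq_eq_abs]
  exact Real.sqrt_le_sqrt ((Finset.single_le_sum (f := fun i => (v i : ℝ) ^ 2)
    (fun i _ => sq_nonneg _) (Finset.mem_univ i)).trans h)

theorem abs_sum_mul_le_sqrt {k : ℕ} (r e : Fin k → ℤ) {T t : ℝ} (hr : ∑ i, (r i : ℝ) ^ 2 ≤ T)
    (he : ∑ i, (e i : ℝ) ^ 2 ≤ t) : |∑ i, (r i : ℝ) * e i| ≤ Real.sqrt (T * t) := by
  rw [← Real.sqrt_sq_eq_abs]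
  refine Real.sqrt_le_sqrt ((Finset.sum_mul_sq_le_sq_mul_sq _ _ _).trans ?_)
  exact mul_le_mul hr he (Finset.sum_nonneg fun _ _ => sq_nonneg _)
    ((Finset.sum_nonneg fun _ _ => sq_nonneg _).trans hr)

/-- Decryption succeeds if the columns of the key are short preimages of the columns of `U` and the
noise vectors are short: then `x - y = e₀ - Rᵀ e`, which is small by Cauchy–Schwarz. -/
theorem decrypts_of_short {n m q : ℕ} [NeZero q] (A : Matrix (Fin n) (Fin m) (ZMod q))
    (U : Matrix (Fin n) (Fin n) (ZMod q)) (R : Matrix (Fin m) (Fin n) ℤ) (s : Fin n → ZMod q)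
    (e₀ : Fin n → ℤ) (e : Fin m → ℤ) {T t : ℝ}
    (hmem : ∀ i, (fun j => R j i) ∈ syndromes A fun j => U j i)
    (hR : ∀ i, ∑ j, (R j i : ℝ) ^ 2 ≤ T) (he₀ : ∑ i, (e₀ i : ℝ) ^ 2 ≤ t)
    (he : ∑ i, (e i : ℝ) ^ 2 ≤ t)
    (hq : Real.sqrt t + Real.sqrt (T * t) < ((q / 4 : ℕ) : ℝ)) :
    Decrypts A U R s e₀ e := by
  intro α
  refine qDecrypt_cipherState R _ _ (fun i => e₀ i - ∑ j, R j i * e j) (fun i => ?_)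
    (fun i => ?_) α
  · have h1 := abs_le_sqrt_of_sum_sq_le e₀ he₀ i
    have h2 := abs_sum_mul_le_sqrt (fun j => R j i) e (hR i) he
    have h3 := (abs_sub (e₀ i : ℝ) (∑ j, (R j i : ℝ) * e j)).trans (add_le_add h1 h2)
    rw [← Int.cast_lt (R := ℝ), Int.cast_natCast, Int.cast_abs, Int.cast_sub, Int.cast_sum]
    simp only [Int.cast_mul]
    exact h3.trans_lt hq
  · have hARs : (R.map (Int.cast : ℤ → ZMod q)).transpose.mulVec (A.transpose.mulVec s) i
        = U.transpose.mulVec s i := by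
      rw [Matrix.mulVec_mulVec, ← Matrix.transpose_mul]
      have hAR : ∀ k, (A * R.map (Int.cast : ℤ → ZMod q)) k i = U k i :=
        fun k => congrFun (hmem i) k
      simp only [Matrix.mulVec, dotProduct, Matrix.transpose_apply, hAR]
    have hRe : (R.map (Int.cast : ℤ → ZMod q)).transpose.mulVec (modVec q e) i
        = ((∑ j, R j i * e j : ℤ) : ZMod q) := by
      simp [Matrix.mulVec, dotProduct, modVec]
    change (U.transpose.mulVec s + modVec q e₀) i
      - (R.map (Int.cast : ℤ → ZMod q)).transpose.mulVec
        (A.transpose.mulVec s + modVec q e) i = _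
    rw [Matrix.mulVec_add, Pi.add_apply, Pi.add_apply, hARs, hRe, Int.cast_sub, modVec]
    ring

theorem sum_sq_le_of_mem_box {m b : ℕ} (r : Fin m → ℤ) (hr : ∀ i, 0 ≤ r i ∧ r i < b) :
    ∑ i, (r i : ℝ) ^ 2 ≤ m * (b : ℝ) ^ 2 := by
  have h : ∀ i ∈ Finset.univ, (r i : ℝ) ^ 2 ≤ (b : ℝ) ^ 2 := fun i _ =>
    pow_le_pow_left₀ (by exact_mod_cast (hr i).1) (by exact_mod_cast (hr i).2.le) 2
  simpa using Finset.sum_le_card_nsmul Finset.univ _ _ h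

/-- A sampler that is close to the discrete Gaussian on a coset with a preimage in `[0, b)^m`
rarely outputs anything but a short preimage. -/
theorem prob_sampler_bad_le {n m q b : ℕ} {A : Matrix (Fin n) (Fin m) (ZMod q)}
    {u : Fin n → ZMod q} {σ : ℝ} (hσ : 0 < σ) {d T : ℝ} (D : PMF (Fin m → ℤ))
    (hu : (syndromes A u).Nonempty)
    (hD : statDist D (discreteGaussian (syndromes A u) hu σ hσ) ≤ d)
    (hbox : ∃ r ∈ syndromes A u, ∀ i, 0 ≤ r i ∧ r i < b)
    (hT : 2 * (m * (b : ℝ) ^ 2) + 2 * σ ^ 2 * m * (1 + σ) ≤ T) :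
    prob D {r | ¬(r ∈ syndromes A u ∧ ∑ i, (r i : ℝ) ^ 2 ≤ T)} ≤ d + Real.exp (-m) := by
  obtain ⟨r, hr, hrb⟩ := hbox
  have hsum := sum_sq_le_of_mem_box r hrb
  have htail := prob_discreteGaussian_tail_le (syndromes A u) hu σ hσ hr (T := T)
    (by linarith)
  refine (prob_le_prob_add_statDist D (discreteGaussian (syndromes A u) hu σ hσ) _).trans ?_
  have h1 : prob (discreteGaussian (syndromes A u) hu σ hσ)
      {r | ¬(r ∈ syndromes A u ∧ ∑ i, (r i : ℝ) ^ 2 ≤ T)} ≤ 0 + Real.exp (-m) := by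
    refine (prob_mono _ (F := (syndromes A u)ᶜ ∪ {x | T < ∑ i, (x i : ℝ) ^ 2}) ?_).trans
      ((prob_union_le _ _ _).trans
        (add_le_add (prob_discreteGaussian_notMem _ hu σ hσ).le htail))
    intro x hx
    by_cases h : x ∈ syndromes A u
    · exact Or.inr (not_le.mp fun h' => hx ⟨h, h'⟩)
    · exact Or.inl h
  linarith

theorem prob_discreteGaussian_univ_tail_le (k : ℕ) {σ : ℝ} (hσ : 0 < σ) {t : ℝ}
    (ht : 2 * σ ^ 2 * k * (1 + σ) ≤ t) :
    prob (discreteGaussian (Set.univ : Set (Fin k → ℤ)) Set.univ_nonempty σ hσ)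
      {x | t < ∑ i, (x i : ℝ) ^ 2} ≤ Real.exp (-k) :=
  prob_discreteGaussian_tail_le _ _ σ hσ (r := 0) (Set.mem_univ _) (by simpa using ht)

/-- The failure probability for a fixed trapdoor pair: a union bound over the `n` key columns and
the two noise vectors. -/
theorem prob_decrypts_compl_le {n m q b : ℕ} [NeZero q] (hnm : n ≤ m)
    {A : Matrix (Fin n) (Fin m) (ZMod q)} {σ : ℝ} (hσ : 0 < σ) {d T t : ℝ}
    (sampleD : (Fin n → ZMod q) → PMF (Fin m → ℤ))
    (hD : ∀ u, ∃ hu : (syndromes A u).Nonempty,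
      statDist (sampleD u) (discreteGaussian (syndromes A u) hu σ hσ) ≤ d)
    (hbox : ∀ u, ∃ r ∈ syndromes A u, ∀ i, 0 ≤ r i ∧ r i < b)
    (ht : 2 * σ ^ 2 * m * (1 + σ) ≤ t) (hT : 2 * (m * (b : ℝ) ^ 2) + t ≤ T)
    (hq : Real.sqrt t + Real.sqrt (T * t) < ((q / 4 : ℕ) : ℝ))
    (U : Matrix (Fin n) (Fin n) (ZMod q)) :
    prob (keyAndCoins σ hσ sampleD U) {p | Decrypts A U p.1 p.2.1 p.2.2.1 p.2.2.2}ᶜ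
      ≤ n * (d + Real.exp (-n)) + 2 * Real.exp (-n) := by
  have hexp : Real.exp (-(m : ℝ)) ≤ Real.exp (-n) :=
    Real.exp_le_exp.mpr (neg_le_neg (by exact_mod_cast hnm))
  have htn : 2 * σ ^ 2 * n * (1 + σ) ≤ t := by
    refine le_trans ?_ ht
    have : (n : ℝ) ≤ m := by exact_mod_cast hnm
    gcongr
  set good : Fin n → Set (Fin m → ℤ) := fun i =>
    {r | r ∈ syndromes A (fun j => U j i) ∧ ∑ j, (r j : ℝ) ^ 2 ≤ T} with hgood
  have hkey : prob (extract sampleD U) {R | ∃ i, (fun j => R j i) ∈ (good i)ᶜ}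
      ≤ n * (d + Real.exp (-n)) := by
    rw [extract, prob_map]
    refine (prob_independent_le (fun i => sampleD fun j => U j i) fun i => (good i)ᶜ).trans ?_
    refine (Finset.sum_le_card_nsmul _ _ (d + Real.exp (-n)) fun i _ => ?_).trans ?_
    · obtain ⟨hu, hd⟩ := hD fun j => U j i
      exact (prob_sampler_bad_le hσ _ hu hd (hbox _) (by linarith)).trans (by linarith)
    · rw [Finset.card_univ, Fintype.card_fin, nsmul_eq_mul]
  refine (prob_bind_le _ _ _ {R | ∃ i, (fun j => R j i) ∈ (good i)ᶜ}
    (c := 2 * Real.exp (-n)) (by positivity) fun R hR => ?_).trans (by linarith)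
  have hR' : ∀ i, (fun j => R j i) ∈ good i := by simpa using hR
  rw [prob_map, encryptCoins]
  -- No exceptional set of `s` is needed: the noise does not depend on `s`.
  refine (prob_bind_le _ _ _ ∅ (c := 2 * Real.exp (-n)) (by positivity) fun s _ => ?_).trans
    (by simp [prob])
  refine (prob_bind_le _ _ _ {x | t < ∑ i, (x i : ℝ) ^ 2} (c := Real.exp (-m))
    (Real.exp_pos _).le fun e₀ he₀ => ?_).trans ?_
  · rw [prob_map]
    refine (prob_mono _ fun e he => ?_).trans (prob_discreteGaussian_univ_tail_le m hσ ht)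
    by_contra h
    refine he ?_
    exact decrypts_of_short A U R s e₀ e (fun i => (hR' i).1) (fun i => (hR' i).2)
      (not_lt.mp he₀) (not_lt.mp h) hq
  · have := prob_discreteGaussian_univ_tail_le n hσ htn
    linarith

/-! ### Choice of parameters -/

/-- Bounds that make decryption work: the integer box `[0, b)^m` is large enough to contain
preimages of all syndromes under almost all matrices, Gaussian noise has squared norm at most `t`
and Gaussian preimages have squared norm at most `T` except with exponentially small probability,
and the resulting decryption noise stays below `⌊q/4⌋`. -/
structure Admissible (n m q : ℕ) (σ : ℝ) (b : ℕ) (T t : ℝ) : Prop where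
  box_pos : 0 < b
  box_le : b ≤ q
  cover : (q : ℝ) ^ (2 * n) / (b : ℝ) ^ m ≤ Real.exp (-n)
  noise : 2 * σ ^ 2 * m * (1 + σ) ≤ t
  key : 2 * (m * (b : ℝ) ^ 2) + t ≤ T
  decode : Real.sqrt t + Real.sqrt (T * t) < ((q / 4 : ℕ) : ℝ)

/-- The parameters fit together once `q = z ^ 42` is large: with `m = O(z ^ 12)` and
`σ = O(z ^ 6)`, a box of side `b ≈ 2 z ^ 14 = 2 q ^ (1 / 3)` is large enough to cover all syndromes,
and the decryption noise is `O(z ^ 35) = O(q ^ (5 / 6))`. -/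
theorem exists_parameters {n m q : ℕ} {σ z c₁ c₂ : ℝ} (hσ : 0 < σ) (hz : z ^ 42 = q)
    (hz3 : 3 ≤ z) (hc₁ : 0 ≤ c₁) (hc₂ : 0 ≤ c₂) (hm : (m : ℝ) ≤ c₁ * z ^ 12)
    (hσz : σ ≤ c₂ * z ^ 6) (hnm : 6 * n ≤ m)
    (hlarge : 4 * (Real.sqrt (2 * c₂ ^ 2 * c₁ * (1 + c₂))
      + Real.sqrt ((18 * c₁ + 2 * c₂ ^ 2 * c₁ * (1 + c₂)) * (2 * c₂ ^ 2 * c₁ * (1 + c₂))) + 1)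
        ≤ z ^ 7) :
    ∃ (b : ℕ) (T t : ℝ), Admissible n m q σ b T t := by
  have hz0 : 0 < z := by linarith
  have hz1 : 1 ≤ z := by linarith
  set K : ℝ := 2 * c₂ ^ 2 * c₁ * (1 + c₂) with hK
  have hK0 : 0 ≤ K := by positivity
  set b : ℕ := ⌈2 * z ^ 14⌉₊ with hb
  have hb2 : 2 * z ^ 14 ≤ b := Nat.le_ceil _
  have hz14 : 1 ≤ z ^ 14 := one_le_pow₀ hz1
  have hb3 : (b : ℝ) ≤ 3 * z ^ 14 := by
    have := (Nat.ceil_lt_add_one (by positivity : 0 ≤ 2 * z ^ 14)).le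
    linarith
  refine ⟨b, (18 * c₁ + K) * z ^ 40, K * z ^ 30, ?_, ?_, ?_, ?_, ?_, ?_⟩
  · exact Nat.ceil_pos.mpr (by positivity)
  · have h1 : (3 : ℝ) * z ^ 14 ≤ z ^ 42 := by
      calc (3 : ℝ) * z ^ 14 ≤ z * z ^ 14 := by gcongr
        _ = z ^ 15 := by ring
        _ ≤ z ^ 42 := pow_le_pow_right₀ hz1 (by norm_num)
    have h2 : (b : ℝ) ≤ q := by rw [← hz]; exact hb3.trans h1
    exact_mod_cast h2
  · have hb1 : (1 : ℝ) ≤ b := by linarith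
    have h1 : (64 : ℝ) ^ n * (q : ℝ) ^ (2 * n) ≤ (b : ℝ) ^ m := by
      calc (64 : ℝ) ^ n * (q : ℝ) ^ (2 * n) = ((2 * z ^ 14) ^ 6) ^ n := by
            rw [← hz, pow_mul _ 2 n, ← mul_pow]
            congr 1
            ring
        _ ≤ ((b : ℝ) ^ 6) ^ n := by gcongr
        _ = (b : ℝ) ^ (6 * n) := (pow_mul _ _ _).symm
        _ ≤ (b : ℝ) ^ m := pow_le_pow_right₀ hb1 hnm
    have h2 : Real.exp n ≤ 64 ^ n := by
      rw [← Real.exp_one_pow n]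
      exact pow_le_pow_left₀ (Real.exp_pos _).le (by linarith [Real.exp_one_lt_d9]) n
    rw [div_le_iff₀ (by positivity), Real.exp_neg, inv_mul_eq_div, le_div_iff₀ (Real.exp_pos _)]
    calc (q : ℝ) ^ (2 * n) * Real.exp n ≤ (q : ℝ) ^ (2 * n) * 64 ^ n := by gcongr
      _ = 64 ^ n * (q : ℝ) ^ (2 * n) := mul_comm _ _
      _ ≤ _ := h1
  · have hz6 : 1 ≤ z ^ 6 := one_le_pow₀ hz1
    calc 2 * σ ^ 2 * m * (1 + σ)
        ≤ 2 * (c₂ * z ^ 6) ^ 2 * (c₁ * z ^ 12) * (z ^ 6 + c₂ * z ^ 6) := by gcongr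
      _ = K * z ^ 30 := by rw [hK]; ring
  · have h1 : 2 * (m * (b : ℝ) ^ 2) ≤ 18 * c₁ * z ^ 40 := by
      calc 2 * (m * (b : ℝ) ^ 2) ≤ 2 * ((c₁ * z ^ 12) * (3 * z ^ 14) ^ 2) := by gcongr
        _ = 18 * c₁ * z ^ 40 := by ring
    have h2 : z ^ 30 ≤ z ^ 40 := pow_le_pow_right₀ hz1 (by norm_num)
    nlinarith
  · have h1 : Real.sqrt (K * z ^ 30) = Real.sqrt K * z ^ 15 := by
      rw [Real.sqrt_mul hK0, show z ^ 30 = (z ^ 15) ^ 2 by ring, Real.sqrt_sq (by positivity)]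
    have h2 : Real.sqrt ((18 * c₁ + K) * z ^ 40 * (K * z ^ 30))
        = Real.sqrt ((18 * c₁ + K) * K) * z ^ 35 := by
      rw [show (18 * c₁ + K) * z ^ 40 * (K * z ^ 30) = (18 * c₁ + K) * K * (z ^ 35) ^ 2 by ring,
        Real.sqrt_mul (by positivity), Real.sqrt_sq (by positivity)]
    have h3 : z ^ 15 ≤ z ^ 35 := pow_le_pow_right₀ hz1 (by norm_num)
    have h4 : Real.sqrt K * z ^ 15 ≤ Real.sqrt K * z ^ 35 := by gcongr
    have h5 : 1 ≤ z ^ 35 := one_le_pow₀ hz1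
    have h6 := mul_le_mul_of_nonneg_right hlarge (by positivity : 0 ≤ z ^ 35)
    have h7 : z ^ 7 * z ^ 35 = q := by rw [← hz]; ring
    have h8 : (q : ℝ) < 4 * ((q / 4 : ℕ) : ℝ) + 4 := by
      have : q < 4 * (q / 4) + 4 := by omega
      exact_mod_cast this
    rw [h1, h2]
    nlinarith

theorem tendsto_atTop_of_isBigO {f g : ℕ → ℝ} (h : f =O[Filter.atTop] g)
    (hf : Filter.Tendsto f Filter.atTop Filter.atTop) (hg : ∀ lam, 0 ≤ g lam) :
    Filter.Tendsto g Filter.atTop Filter.atTop := by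
  obtain ⟨c, hc0, hc⟩ := h.exists_pos
  refine Filter.tendsto_atTop_mono' _ ?_ (hf.atTop_div_const hc0)
  filter_upwards [hc.bound] with lam hlam
  rw [div_le_iff₀ hc0, mul_comm]
  rw [Real.norm_of_nonneg (hg lam)] at hlam
  exact (le_abs_self _).trans hlam

theorem eventually_exists_parameters {n m q : ℕ → ℕ} {σ : ℕ → ℝ} (hσ : ∀ lam, 0 < σ lam)
    (hn : (fun lam => (n lam : ℝ)) =Θ[Filter.atTop] fun lam : ℕ => (lam : ℝ))
    (hm : ∀ lam, 6 * n lam ≤ m lam)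
    (hσn : σ =O[Filter.atTop] fun lam => Real.sqrt (n lam))
    (hq : (fun lam => (m lam : ℝ) ^ (3.5 : ℝ)) =O[Filter.atTop] fun lam => (q lam : ℝ)) :
    ∀ᶠ lam in Filter.atTop, ∃ (b : ℕ) (T t : ℝ),
      Admissible (n lam) (m lam) (q lam) (σ lam) b T t := by
  obtain ⟨c, hc0, hc⟩ := hq.exists_pos
  obtain ⟨C, hC0, hC⟩ := hσn.exists_pos
  -- `q ≥ m ^ 3.5 / c` tends to infinity since `m ≥ 6 n` does.
  have hn_top : Filter.Tendsto (fun lam => (n lam : ℝ)) Filter.atTop Filter.atTop :=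
    tendsto_atTop_of_isBigO hn.isBigO_symm tendsto_natCast_atTop_atTop
      fun _ => Nat.cast_nonneg _
  have hm_top : Filter.Tendsto (fun lam => (m lam : ℝ)) Filter.atTop Filter.atTop := by
    refine Filter.tendsto_atTop_mono (fun lam => ?_) hn_top
    have := hm lam
    exact_mod_cast (by omega : n lam ≤ m lam)
  have hq_top : Filter.Tendsto (fun lam => (q lam : ℝ)) Filter.atTop Filter.atTop :=
    tendsto_atTop_of_isBigO hq ((tendsto_rpow_atTop (by norm_num)).comp hm_top)
      fun _ => Nat.cast_nonneg _
  have hz_top : Filter.Tendsto (fun lam => (q lam : ℝ) ^ (1 / 42 : ℝ)) Filter.atTop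
      Filter.atTop := (tendsto_rpow_atTop (by norm_num)).comp hq_top
  set c₁ : ℝ := c ^ (2 / 7 : ℝ) with hc₁
  have hc₁0 : 0 ≤ c₁ := by positivity
  set c₂ : ℝ := C * Real.sqrt c₁ with hc₂
  have hc₂0 : 0 ≤ c₂ := by positivity
  have hz7_top := (Filter.tendsto_pow_atTop (α := ℝ) (n := 7) (by norm_num)).comp hz_top
  filter_upwards [hc.bound, hC.bound, hz_top.eventually_ge_atTop 3,
    hz7_top.eventually_ge_atTop (4 * (Real.sqrt (2 * c₂ ^ 2 * c₁ * (1 + c₂))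
      + Real.sqrt ((18 * c₁ + 2 * c₂ ^ 2 * c₁ * (1 + c₂)) * (2 * c₂ ^ 2 * c₁ * (1 + c₂))) + 1))]
    with lam h1 h2 h3 h4
  set z : ℝ := (q lam : ℝ) ^ (1 / 42 : ℝ) with hz
  have hz0 : 0 ≤ z := by positivity
  have hz42 : z ^ 42 = q lam := by
    rw [hz, ← Real.rpow_natCast, ← Real.rpow_mul (Nat.cast_nonneg _)]
    norm_num
  have hmz : (m lam : ℝ) ≤ c₁ * z ^ 12 := by
    have h5 : ((m lam : ℝ) ^ (3.5 : ℝ)) ≤ c * z ^ 42 := by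
      rw [hz42]
      simpa [abs_of_nonneg (Real.rpow_nonneg (Nat.cast_nonneg (m lam)) _)] using h1
    calc (m lam : ℝ) = ((m lam : ℝ) ^ (3.5 : ℝ)) ^ (2 / 7 : ℝ) := by
          rw [← Real.rpow_mul (Nat.cast_nonneg _)]
          norm_num
      _ ≤ (c * z ^ 42) ^ (2 / 7 : ℝ) := by gcongr
      _ = c₁ * z ^ 12 := by
          rw [Real.mul_rpow hc0.le (by positivity), ← Real.rpow_natCast z 42,
            ← Real.rpow_mul hz0, ← Real.rpow_natCast z 12, hc₁]
          norm_num
  refine exists_parameters (hσ lam) hz42 h3 hc₁0 hc₂0 hmz ?_ (hm lam) h4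
  calc σ lam ≤ C * Real.sqrt (n lam) := by
        simpa [abs_of_pos (hσ lam), abs_of_nonneg (Real.sqrt_nonneg _)] using h2
    _ ≤ C * Real.sqrt (c₁ * (z ^ 6) ^ 2) := by
        gcongr
        have h6 : (n lam : ℝ) ≤ m lam := by
          have := hm lam
          exact_mod_cast (by omega : n lam ≤ m lam)
        calc (n lam : ℝ) ≤ m lam := h6
          _ ≤ c₁ * z ^ 12 := hmz
          _ = c₁ * (z ^ 6) ^ 2 := by ring
    _ = c₂ * z ^ 6 := by
        rw [Real.sqrt_mul hc₁0, Real.sqrt_sq (by positivity), hc₂]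
        ring

/-! ### Negligible functions -/

theorem negligible_abs {δ : ℕ → ℝ} (h : Negligible δ) : Negligible fun lam => |δ lam| :=
  Asymptotics.SuperpolynomialDecay.trans_abs_le h fun _ => (abs_abs _).le

theorem negligible_mul_of_isBigO {δ f : ℕ → ℝ} (h : Negligible δ)
    (hf : f =O[Filter.atTop] fun lam : ℕ => (lam : ℝ)) : Negligible fun lam => f lam * δ lam := by
  obtain ⟨C, hC⟩ := hf.bound
  refine Asymptotics.SuperpolynomialDecay.trans_eventually_abs_le
    ((Asymptotics.SuperpolynomialDecay.param_mul h).const_mul C) ?_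
  filter_upwards [hC] with lam hlam
  simp only [Function.comp_apply, Pi.mul_apply, abs_mul]
  rw [← mul_assoc]
  refine mul_le_mul_of_nonneg_right (hlam.trans ?_) (abs_nonneg _)
  exact mul_le_mul_of_nonneg_right (le_abs_self C) (norm_nonneg _)

theorem negligible_exp_neg {f : ℕ → ℝ} (hf : (fun lam : ℕ => (lam : ℝ)) =O[Filter.atTop] f)
    (hf0 : ∀ lam, 0 ≤ f lam) : Negligible fun lam => Real.exp (-f lam) := by
  obtain ⟨c, hc0, hc⟩ := hf.exists_pos
  have hexp : Negligible fun lam => Real.exp (-(1 / c) * lam) := fun k => by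
    have h := (tendsto_rpow_mul_exp_neg_mul_atTop_nhds_zero k (1 / c) (by positivity)).comp
      (tendsto_natCast_atTop_atTop (R := ℝ))
    simpa [Function.comp_def] using h
  refine Asymptotics.SuperpolynomialDecay.trans_eventually_abs_le hexp ?_
  filter_upwards [hc.bound] with lam hlam
  simp only [Function.comp_apply, Real.abs_exp]
  refine Real.exp_le_exp.mpr ?_
  rw [Real.norm_natCast, Real.norm_of_nonneg (hf0 lam)] at hlam
  have : 1 / c * (lam : ℝ) ≤ f lam := by
    rw [one_div, inv_mul_eq_div, div_le_iff₀ hc0]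
    linarith
  linarith

end QIBE

end

open QIBE in
theorem mainTheorem2
    (n m q : ℕ → ℕ) (σ : ℕ → ℝ)
    [∀ lam, Fact (q lam).Prime]
    (hσ : ∀ lam, 0 < σ lam)
    (hn : (fun lam => (n lam : ℝ)) =Θ[Filter.atTop] fun lam : ℕ => (lam : ℝ))
    (hm : ∀ lam, 6 * n lam ≤ m lam)
    (hσn : σ =O[Filter.atTop] fun lam => Real.sqrt (n lam))
    (hq : (fun lam => (q lam : ℝ)) =Θ[Filter.atTop] fun lam => (m lam : ℝ) ^ (3.5 : ℝ))
    (trapGen : ∀ lam, PMF (Matrix (Fin (n lam)) (Fin (m lam)) (ZMod (q lam)) ×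
      Matrix (Fin (m lam)) (Fin (m lam)) ℤ))
    (sampleD : ∀ lam, Matrix (Fin (n lam)) (Fin (m lam)) (ZMod (q lam)) →
      Matrix (Fin (m lam)) (Fin (m lam)) ℤ → (Fin (n lam) → ZMod (q lam)) →
      PMF (Fin (m lam) → ℤ))
    (hTrapGen : ∃ δ : ℕ → ℝ, QIBE.Negligible δ ∧ ∀ lam,
      QIBE.statDist ((trapGen lam).map Prod.fst) (PMF.uniformOfFintype _) ≤ δ lam)
    (hSampleD : ∃ δ : ℕ → ℝ, QIBE.Negligible δ ∧ ∀ lam,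
      1 - δ lam ≤ QIBE.prob (trapGen lam) {K | ∀ u : Fin (n lam) → ZMod (q lam),
        ∃ hu : (QIBE.syndromes K.1 u).Nonempty,
          QIBE.statDist (sampleD lam K.1 K.2 u)
            (QIBE.discreteGaussian (QIBE.syndromes K.1 u) hu (σ lam) (hσ lam)) ≤ δ lam}) :
    ∃ ε : ℕ → ℝ, QIBE.Negligible ε ∧ ∀ lam,
      1 - ε lam ≤ QIBE.prob (trapGen lam) {K |
        ∀ (H : (Fin (n lam) → Bool) → Matrix (Fin (n lam)) (Fin (n lam)) (ZMod (q lam)))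
          (ident : Fin (n lam) → Bool),
          1 - ε lam ≤ QIBE.prob
            (QIBE.keyAndCoins (σ lam) (hσ lam) (sampleD lam K.1 K.2) (H ident))
            {t | QIBE.Decrypts K.1 (H ident) t.1 t.2.1 t.2.2.1 t.2.2.2}} := by
  classical
  obtain ⟨δ₁, hδ₁, hA⟩ := hTrapGen
  obtain ⟨δ₂, hδ₂, hS⟩ := hSampleD
  have hev := eventually_exists_parameters hσ hn hm hσn hq.isBigO_symm
  set ε₀ : ℕ → ℝ := fun lam => |δ₁ lam| + |δ₂ lam| + n lam * |δ₂ lam|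
    + n lam * Real.exp (-(n lam : ℝ)) + 2 * Real.exp (-(n lam : ℝ)) with hε₀
  have hexp : Negligible fun lam => Real.exp (-(n lam : ℝ)) :=
    negligible_exp_neg hn.isBigO_symm fun _ => Nat.cast_nonneg _
  have hε₀n : Negligible ε₀ :=
    ((((negligible_abs hδ₁).add (negligible_abs hδ₂)).add
      (negligible_mul_of_isBigO (negligible_abs hδ₂) hn.isBigO)).add
      (negligible_mul_of_isBigO hexp hn.isBigO)).add (hexp.const_mul 2)
  -- Only finitely many `lam` have no admissible bounds; there `ε = 1` makes the claim trivial.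
  refine ⟨fun lam =>
    if ∃ (b : ℕ) (T t : ℝ), Admissible (n lam) (m lam) (q lam) (σ lam) b T t then ε₀ lam else 1, ?_, ?_⟩
  · refine Asymptotics.SuperpolynomialDecay.congr' hε₀n ?_
    filter_upwards [hev] with lam hlam
    rw [if_pos hlam]
  intro lam
  by_cases hlam : ∃ (b : ℕ) (T t : ℝ), Admissible (n lam) (m lam) (q lam) (σ lam) b T t
  swap
  · simp only [if_neg hlam, sub_self]
    exact prob_nonneg _ _
  simp only [if_pos hlam]
  obtain ⟨b, T, t, hadm⟩ := hlam
  have hE0 := Real.exp_pos (-(n lam : ℝ))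
  have hn0 : (0 : ℝ) ≤ n lam := Nat.cast_nonneg _
  have hnE : 0 ≤ n lam * Real.exp (-(n lam : ℝ)) := by positivity
  have hnd : 0 ≤ n lam * |δ₂ lam| := by positivity
  have hnd' : n lam * δ₂ lam ≤ n lam * |δ₂ lam| :=
    mul_le_mul_of_nonneg_left (le_abs_self _) hn0
  set short : Set (Matrix (Fin (n lam)) (Fin (m lam)) (ZMod (q lam))) :=
    {A | ∀ u, ∃ r ∈ syndromes A u, ∀ i, 0 ≤ r i ∧ r i < b} with hshort
  set close : Set (Matrix (Fin (n lam)) (Fin (m lam)) (ZMod (q lam)) ×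
      Matrix (Fin (m lam)) (Fin (m lam)) ℤ) :=
    {K | ∀ u : Fin (n lam) → ZMod (q lam), ∃ hu : (syndromes K.1 u).Nonempty,
      statDist (sampleD lam K.1 K.2 u)
        (discreteGaussian (syndromes K.1 u) hu (σ lam) (hσ lam)) ≤ δ₂ lam} with hclose
  have h1 : prob (trapGen lam) (Prod.fst ⁻¹' shortᶜ) ≤ Real.exp (-(n lam : ℝ)) + |δ₁ lam| := by
    rw [← prob_map]
    refine (prob_le_prob_add_statDist _ (PMF.uniformOfFintype _) _).trans
      (add_le_add ?_ ((hA lam).trans (le_abs_self _)))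
    exact (prob_uniform_no_short_syndrome_le hadm.box_pos hadm.box_le).trans hadm.cover
  have h2 : prob (trapGen lam) closeᶜ ≤ |δ₂ lam| := by
    rw [prob_compl]
    have := hS lam
    have := le_abs_self (δ₂ lam)
    linarith
  have h3 : prob (trapGen lam) (Prod.fst ⁻¹' shortᶜ ∪ closeᶜ) ≤ ε₀ lam := by
    refine (prob_union_le _ _ _).trans ?_
    simp only [hε₀]
    linarith
  have h4 : 1 - ε₀ lam ≤ prob (trapGen lam) (Prod.fst ⁻¹' shortᶜ ∪ closeᶜ)ᶜ := by
    rw [prob_compl]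
    linarith
  refine h4.trans (prob_mono _ ?_)
  intro K hK H ident
  simp only [Set.mem_compl_iff, Set.mem_union, not_or, not_not, Set.mem_preimage] at hK
  have h5 := prob_decrypts_compl_le (by have := hm lam; omega) (hσ lam)
    (sampleD lam K.1 K.2) hK.2 hK.1 hadm.noise hadm.key hadm.decode (H ident)
  rw [prob_compl] at h5
  have := abs_nonneg (δ₁ lam)
  have := abs_nonneg (δ₂ lam)
  simp only [hε₀]
  linarith
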